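/- **Setting.** Let $M$ be a smooth real manifold of dimension $n+1$ and let $\pi:M\to\mathbb R$ be a smooth surjective submersion. Let $\pi_{10}:J^1\pi\to M$, $\pi_{10}(j^1_t\gamma)=\gamma(t)$, be the bundle of first jets of local smooth sections of $\pi$. Charts $(t,x^i)$ of $M$ with $t=\pi$ induce charts $(t,x^i,y^i)$ of $J^1\pi$; write also $t$ for the function $\pi\circ\pi_{10}$ on $J^1\pi$, and let $J=\frac{\partial}{\partial y^i}\otimes(dx^i-y^i\,dt)$ be the vertical endomorphism of $J^1\pi$ (this does not depend on the chart). For a smooth $k$-form $\omega$ on $J^1\pi$ or on an open subset of it put $$(i_J\omega)(X_1,\dots,X_k)=\sum_{i=1}^k\omega(X_1,\dots,JX_i,\dots,X_k),\qquad d_J\omega=i_J\,d\omega-d\,i_J\omega$$ (so $i_J\omega=0$ for $k=0$). A smooth $k$-form $\theta$ is called * *$d_J$-closed (modulo $dt$)* if $d_J\theta\wedge dt=0$; * *$d_J$-exact (modulo $dt$)* on an open set $U\subseteq J^1\pi$ if there is a smooth $(k-1)$-form $\omega$ on $U$ with $\theta\wedge dt=d_J\omega\wedge dt$ on $U$ (for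 $k=0$ the only form of degree $-1$ is $0$, and the condition reads $\theta\wedge dt=0$); * *semi-basic*, for $k\ge1$, if $\theta(X_1,\dots,X_k)=0$ whenever one of the $X_i$ is vertical, i.e. lies in the kernel of the differential of $\pi_{10}$. **Lemma (Poincaré-type Lemma).** Let $\theta$ be a smooth $k$-form on $J^1\pi$. (i) If $\theta$ is $d_J$-exact (modulo $dt$) on $J^1\pi$, then $\theta$ is $d_J$-closed (modulo $dt$). (ii) If $k\ge1$ and $\theta$ is semi-basic and $d_J$-closed (modulo $dt$), then $\theta$ is locally $d_J$-exact (modulo $dt$): every point of $J^1\pi$ has an open neighbourhood on which $\theta$ is $d_J$-exact (modulo $dt$). -/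

import Mathlib

open scoped Manifold ContDiff Topology

set_option linter.unusedSectionVars false

noncomputable section

namespace JetForms

/-! ### Pointwise (multi)linear algebra -/

section Linear

variable {T : Type*} [AddCommGroup T] [Module ℝ T] [TopologicalSpace T]
  {k : ℕ}

/-- The algebraic derivation `i_A B (X₁, …, X_k) = ∑ᵢ B (X₁, …, A Xᵢ, …, X_k)` of an alternating
`k`-form `B` by an endomorphism `A` (it is `0` for `k = 0`). -/
def insertEndo (A : T →L[ℝ] T) (B : T [⋀^Fin k]→L[ℝ] ℝ) : T [⋀^Fin k]→L[ℝ] ℝ :=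
  { (∑ i : Fin k, B.toContinuousMultilinearMap.compContinuousLinearMap
      (fun j => if j = i then A else ContinuousLinearMap.id ℝ T)) with
    map_eq_zero_of_eq' := by
      intro v i j hij hne
      have key : ∀ l : Fin k, (fun m => (if m = l then A else ContinuousLinearMap.id ℝ T) (v m))
          = Function.update v l (A (v l)) := by
        intro l; funext m
        by_cases h : m = l
        · subst h; simp
        · simp [h]
      change (∑ l : Fin k, B.toContinuousMultilinearMap.compContinuousLinearMap
        (fun j => if j = l then A else ContinuousLinearMap.id ℝ T)) v = 0
      simp only [sum_apply,
        ContinuousMultilinearMap.compContinuousLinearMap_apply, key]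
      rw [Finset.sum_eq_add i j hne]
      · have h := B.map_swap (Function.update v i (A (v i))) hne
        have h2 : (Function.update v i (A (v i))) ∘ Equiv.swap i j
            = Function.update v j (A (v j)) := by
          funext m
          by_cases h1 : m = i
          · subst h1; simp [hne, hne.symm, hij]
          · by_cases h3 : m = j
            · subst h3; simp [hij]
            · simp [Equiv.swap_apply_of_ne_of_ne h1 h3, h1, h3]
        rw [h2] at h
        change B.toAlternatingMap _ + B.toAlternatingMap _ = 0
        rw [h]; simp
      · intro l _ hl
        exact B.map_eq_zero_of_eq _ (by simp [hl.1.symm, hl.2.symm, hij]) hne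
      · simp
      · simp }

theorem insertEndo_apply (A : T →L[ℝ] T) (B : T [⋀^Fin k]→L[ℝ] ℝ) (v : Fin k → T) :
    insertEndo A B v = ∑ i, B (Function.update v i (A (v i))) := by
  change (∑ l : Fin k, B.toContinuousMultilinearMap.compContinuousLinearMap
        (fun j => if j = l then A else ContinuousLinearMap.id ℝ T)) v = _
  simp only [sum_apply,
    ContinuousMultilinearMap.compContinuousLinearMap_apply]
  refine Finset.sum_congr rfl fun l _ => ?_
  change B _ = B _
  congr 1
  funext m
  by_cases h : m = l
  · subst h; simp
  · simp [h]

/-- The wedge product `η ∧ α` of an alternating `k`-form `η` with a linear form `α`: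
`(η ∧ α) (X₀, …, X_k) = (-1)^k ∑ᵢ (-1)^i α (Xᵢ) η (X₀, …, X̂ᵢ, …, X_k)`. -/
def wedgeOne (η : T [⋀^Fin k]→L[ℝ] ℝ) (α : T →L[ℝ] ℝ) : T [⋀^Fin (k + 1)]→L[ℝ] ℝ :=
  { AlternatingMap.alternatizeUncurryFin
      ((-1 : ℝ) ^ k • (α : T →ₗ[ℝ] ℝ).smulRight η.toAlternatingMap) with
    cont := by
      change Continuous fun v => (AlternatingMap.alternatizeUncurryFin
        ((-1 : ℝ) ^ k • (α : T →ₗ[ℝ] ℝ).smulRight η.toAlternatingMap)) v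
      simp only [AlternatingMap.alternatizeUncurryFin_apply]
      refine continuous_finsetSum _ fun i _ => ?_
      change Continuous fun v : Fin (k + 1) → T =>
        (-1 : ℤ) ^ (i : ℕ) • ((-1 : ℝ) ^ k • (α (v i) • η (i.removeNth v)))
      have h2 : Continuous fun v : Fin (k + 1) → T => i.removeNth v :=
        continuous_pi fun j => continuous_apply _
      exact (((α.continuous.comp (continuous_apply i)).smul (η.cont.comp h2)).const_smul
        ((-1 : ℝ) ^ k)).const_smul ((-1 : ℤ) ^ (i : ℕ)) }

theorem wedgeOne_apply (η : T [⋀^Fin k]→L[ℝ] ℝ) (α : T →L[ℝ] ℝ) (v : Fin (k + 1) → T) :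
    wedgeOne η α v =
      (-1) ^ k * ∑ i : Fin (k + 1), (-1) ^ (i : ℕ) * (α (v i) * η (i.removeNth v)) := by
  change (AlternatingMap.alternatizeUncurryFin
        ((-1 : ℝ) ^ k • (α : T →ₗ[ℝ] ℝ).smulRight η.toAlternatingMap)) v = _
  rw [AlternatingMap.alternatizeUncurryFin_apply, Finset.mul_sum]
  refine Finset.sum_congr rfl fun i _ => ?_
  change (-1 : ℤ) ^ (i : ℕ) • ((-1 : ℝ) ^ k • (α (v i) • η (i.removeNth v))) = _
  simp only [smul_eq_mul, zsmul_eq_mul]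
  push_cast
  ring

end Linear

/-! ### Differential forms on a smooth manifold without boundary -/

section Forms

variable {V : Type*} [NormedAddCommGroup V] [NormedSpace ℝ V]
  {P : Type*} [TopologicalSpace P] [ChartedSpace V P] {k : ℕ}

variable (V P) in
/-- Fields of alternating `k`-linear forms on the tangent spaces of `P`. -/
abbrev FormField (k : ℕ) : Type _ := (u : P) → TangentSpace 𝓘(ℝ, V) u [⋀^Fin k]→L[ℝ] ℝ

variable (V P) in
/-- `(1,1)`-tensor fields on `P`, i.e. vector valued `1`-forms. -/
abbrev EndoField : Type _ := (u : P) → TangentSpace 𝓘(ℝ, V) u →L[ℝ] TangentSpace 𝓘(ℝ, V) u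

variable (V P) in
/-- Fields of linear forms on the tangent spaces of `P`. -/
abbrev CovectorField : Type _ := (u : P) → TangentSpace 𝓘(ℝ, V) u →L[ℝ] ℝ

/-- The expression of a form in a chart `φ`: its pull-back by `φ⁻¹`. -/
def formInChart (φ : OpenPartialHomeomorph P V) (η : FormField V P k) :
    V → V [⋀^Fin k]→L[ℝ] ℝ := fun z =>
  (η (φ.symm z)).compContinuousLinearMap
    ((mfderiv 𝓘(ℝ, V) 𝓘(ℝ, V) φ.symm z).comp
      (NormedSpace.fromTangentSpace (𝕜 := ℝ) z).symm.toContinuousLinearMap)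

/-- A form is smooth on an open set `U` if its expression in every chart of the atlas is
`C^∞` on the part of the chart that lies in `U`. -/
def SmoothFormOn (η : FormField V P k) (U : Set P) : Prop :=
  ∀ φ ∈ atlas V P, ContDiffOn ℝ ∞ (formInChart φ η) (φ.target ∩ φ.symm ⁻¹' U)

/-- The exterior derivative, computed at `u` in the preferred chart at `u`. -/
def extD (η : FormField V P k) : FormField V P (k + 1) := fun u =>
  ContinuousAlternatingMap.compContinuousLinearMap
    (extDeriv (formInChart (chartAt V u) η) (chartAt V u u))
    (mvfderiv 𝓘(ℝ, V) (chartAt V u) u)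

/-- `i_A η`. -/
def insertField (A : EndoField V P) (η : FormField V P k) : FormField V P k := fun u =>
  insertEndo (A u) (η u)

/-- The exterior derivative with respect to a vector valued `1`-form: `d_A = i_A ∘ d - d ∘ i_A`. -/
def extDAlong (A : EndoField V P) (η : FormField V P k) : FormField V P (k + 1) :=
  fun u => insertField A (extD η) u - extD (insertField A η) u

/-- `θ` is `d_A`-closed (modulo `τ`): `d_A θ ∧ τ = 0`. -/
def IsClosedMod (A : EndoField V P) (τ : CovectorField V P) (θ : FormField V P k) : Prop :=
  ∀ u, wedgeOne (extDAlong A θ u) (τ u) = 0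

/-- `θ` is `d_A`-exact (modulo `τ`) on the open set `U`: there is a smooth form `η`, defined on `U`
and of degree one less, with `θ ∧ τ = d_A η ∧ τ` on `U`. There are no forms of degree `-1` but `0`,
so that for functions the condition reads `θ ∧ τ = 0`. (A form on `U` is represented by a field of
forms on `P` whose values outside `U` play no role.) -/
def IsExactModOn (A : EndoField V P) (τ : CovectorField V P) (U : Set P) :
    {k : ℕ} → FormField V P k → Prop
  | 0, θ => ∀ u ∈ U, wedgeOne (θ u) (τ u) = 0
  | k + 1, θ => ∃ η : FormField V P k, SmoothFormOn η U ∧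
      ∀ u ∈ U, wedgeOne (θ u) (τ u) = wedgeOne (extDAlong A η u) (τ u)

end Forms

/-! ### Manifolds fibred over `ℝ` and their first jet bundles -/

/-- The space `ℝ × ℝⁿ` of coordinates `(t, x)`. -/
abbrev BaseModel (n : ℕ) : Type := ℝ × EuclideanSpace ℝ (Fin n)

/-- The space `(ℝ × ℝⁿ) × ℝⁿ` of coordinates `((t, x), y)`. -/
abbrev JetModel (n : ℕ) : Type := BaseModel n × EuclideanSpace ℝ (Fin n)

/-- A fibration `π : M → ℝ` of an `(n+1)`-dimensional manifold: a smooth surjective submersion. -/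
structure FibredOverReal (n : ℕ) (M : Type*) [TopologicalSpace M]
    [ChartedSpace (BaseModel n) M] where
  proj : M → ℝ
  surjective : Function.Surjective proj
  submersion : Manifold.IsSubmersion 𝓘(ℝ, BaseModel n) 𝓘(ℝ, ℝ) ∞ proj

section Jets

variable {n : ℕ} {M : Type*} [TopologicalSpace M] [ChartedSpace (BaseModel n) M]
  [IsManifold 𝓘(ℝ, BaseModel n) ∞ M]

/-- `v = γ'(t)` for a smooth section `γ` of `π` defined on an open neighbourhood of `t`. As a first
jet `j¹_t γ` consists of `t`, `γ t` and the first derivative of `γ` at `t`, these vectors are the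
first jets of local sections. -/
def IsFirstJet (π : FibredOverReal n M) (v : TangentBundle 𝓘(ℝ, BaseModel n) M) : Prop :=
  ∃ (t : ℝ) (I : Set ℝ) (γ : ℝ → M), IsOpen I ∧ t ∈ I ∧
    ContMDiffOn 𝓘(ℝ, ℝ) 𝓘(ℝ, BaseModel n) ∞ γ I ∧ (∀ s ∈ I, π.proj (γ s) = s) ∧
    v = ⟨γ t, mfderiv 𝓘(ℝ, ℝ) 𝓘(ℝ, BaseModel n) γ t ((NormedSpace.fromTangentSpace t).symm 1)⟩

/-- The first jet bundle `J¹π`, realized inside the tangent bundle of `M`. -/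
def Jet (π : FibredOverReal n M) : Type _ := {v // IsFirstJet π v}

instance (π : FibredOverReal n M) : TopologicalSpace (Jet π) :=
  inferInstanceAs (TopologicalSpace {v // IsFirstJet π v})

variable {π : FibredOverReal n M}

/-- The projection `π₁₀ : J¹π → M`. -/
def Jet.base (u : Jet π) : M := u.1.1

/-- The derivative at `t` of a section with first jet `u`. -/
def Jet.vel (u : Jet π) : TangentSpace 𝓘(ℝ, BaseModel n) u.base := u.1.2

/-- Fibred charts `(t, x)` of `M`: the first coordinate is `π`. -/
def IsFibredChart (π : FibredOverReal n M) (e : OpenPartialHomeomorph M (BaseModel n)) : Prop :=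
  e ∈ IsManifold.maximalAtlas 𝓘(ℝ, BaseModel n) ∞ M ∧ ∀ p ∈ e.source, (e p).1 = π.proj p

theorem exists_isFibredChart (π : FibredOverReal n M) (p : M) :
    ∃ e, IsFibredChart π e ∧ p ∈ e.source := by
  obtain ⟨F, _, _, hF⟩ := π.submersion
  obtain ⟨φ, ψ, hp, -, hφ, hψ, hsrc, L, hL⟩ := hF p
  have : FiniteDimensional ℝ (ℝ × F) := L.toLinearEquiv.finiteDimensional
  have : FiniteDimensional ℝ F :=
    FiniteDimensional.of_surjective (LinearMap.snd ℝ ℝ F) LinearMap.snd_surjective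
  have hrk : Module.finrank ℝ F = Module.finrank ℝ (EuclideanSpace ℝ (Fin n)) := by
    have := L.toLinearEquiv.finrank_eq
    simp only [Module.finrank_prod, Module.finrank_self] at this
    omega
  let K : F ≃L[ℝ] EuclideanSpace ℝ (Fin n) := ContinuousLinearEquiv.ofFinrankEq hrk
  let L' : BaseModel n ≃L[ℝ] BaseModel n :=
    L.trans ((ContinuousLinearEquiv.refl ℝ ℝ).prodCongr K)
  have hL' : ∀ q ∈ φ.source, (L' (φ q)).1 = ψ (π.proj q) := by
    intro q hq
    have := hL (x := φ q) (by simpa using φ.map_source hq)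
    simp only [Function.comp_apply] at this
    have h2 : (φ.extend 𝓘(ℝ, BaseModel n)).symm (φ q) = q := by simp [φ.left_inv hq]
    rw [h2] at this
    exact this.symm
  let h : OpenPartialHomeomorph (BaseModel n) (BaseModel n) :=
    ψ.symm.prod (OpenPartialHomeomorph.refl (EuclideanSpace ℝ (Fin n)))
  let e : OpenPartialHomeomorph M (BaseModel n) :=
    (φ.trans L'.toHomeomorph.toOpenPartialHomeomorph).trans h
  have hval : ∀ q, e q = (ψ.symm (L' (φ q)).1, (L' (φ q)).2) := fun q => rfl
  have hsymm : ∀ z, e.symm z = φ.symm (L'.symm (ψ z.1, z.2)) := fun q => rfl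
  have hes : ∀ q, q ∈ e.source ↔ q ∈ φ.source := by
    intro q
    simp only [e, h, OpenPartialHomeomorph.trans_source, Set.mem_inter_iff]
    constructor
    · exact fun hq => hq.1.1
    · intro hq
      refine ⟨⟨hq, trivial⟩, ?_, trivial⟩
      change (L' (φ q)).1 ∈ ψ.target
      rw [hL' q hq]
      exact ψ.map_source (hsrc hq)
  have het : ∀ z, z ∈ e.target → z.1 ∈ ψ.source ∧ L'.symm (ψ z.1, z.2) ∈ φ.target := by
    intro z hz
    exact ⟨hz.1.1, hz.2.2⟩
  refine ⟨e, ⟨?_, ?_⟩, (hes p).2 hp⟩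
  · refine e.mem_maximalAtlas_of_contMDiffOn ?_ ?_
    · have h1 := contMDiffOn_of_mem_maximalAtlas hφ
      have h2 := contMDiffOn_symm_of_mem_maximalAtlas hψ
      have h3 : ContMDiffOn 𝓘(ℝ, BaseModel n) 𝓘(ℝ, BaseModel n) ∞
          (fun q => L' (φ q)) φ.source := L'.contDiff.contMDiff.comp_contMDiffOn h1
      have h4 : ContDiffOn ℝ ∞ (fun z : BaseModel n => (ψ.symm z.1, z.2))
          (Prod.fst ⁻¹' ψ.target) :=
        (h2.contDiffOn.comp contDiff_fst.contDiffOn fun z hz => hz).prodMk contDiff_snd.contDiffOn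
      exact (h4.contMDiffOn.comp (h3.mono fun q hq => (hes q).1 hq) fun q hq => by
        change (L' (φ q)).1 ∈ ψ.target
        rw [hL' q ((hes q).1 hq)]
        exact ψ.map_source (hsrc ((hes q).1 hq)))
    · have h1 := contMDiffOn_symm_of_mem_maximalAtlas hφ
      have h2 := contMDiffOn_of_mem_maximalAtlas hψ
      have h4 : ContDiffOn ℝ ∞ (fun z : BaseModel n => L'.symm (ψ z.1, z.2))
          (Prod.fst ⁻¹' ψ.source) :=
        L'.symm.contDiff.comp_contDiffOn
          ((h2.contDiffOn.comp contDiff_fst.contDiffOn fun z hz => hz).prodMk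
            contDiff_snd.contDiffOn)
      exact h1.comp (h4.contMDiffOn.mono fun z hz => (het z hz).1) fun z hz => (het z hz).2
  · intro q hq
    rw [hval, hL' q ((hes q).1 hq)]
    exact ψ.left_inv (hsrc ((hes q).1 hq))

theorem IsFibredChart.contMDiffOn {e : OpenPartialHomeomorph M (BaseModel n)}
    (he : IsFibredChart π e) :
    ContMDiffOn 𝓘(ℝ, BaseModel n) 𝓘(ℝ, BaseModel n) ∞ e e.source :=
  contMDiffOn_of_mem_maximalAtlas he.1

theorem IsFibredChart.contMDiffOn_symm {e : OpenPartialHomeomorph M (BaseModel n)}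
    (he : IsFibredChart π e) :
    ContMDiffOn 𝓘(ℝ, BaseModel n) 𝓘(ℝ, BaseModel n) ∞ e.symm e.target :=
  contMDiffOn_symm_of_mem_maximalAtlas he.1

theorem IsFibredChart.mdifferentiable {e : OpenPartialHomeomorph M (BaseModel n)}
    (he : IsFibredChart π e) : e.MDifferentiable 𝓘(ℝ, BaseModel n) 𝓘(ℝ, BaseModel n) :=
  ⟨he.contMDiffOn.mdifferentiableOn (by simp), he.contMDiffOn_symm.mdifferentiableOn (by simp)⟩

/-- In a fibred chart a jet has the velocity `(1, y)`. -/
theorem Jet.vel_fst {e : OpenPartialHomeomorph M (BaseModel n)} (he : IsFibredChart π e)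
    (u : Jet π) (hu : u.base ∈ e.source) :
    (mvfderiv 𝓘(ℝ, BaseModel n) e u.base u.vel).1 = 1 := by
  obtain ⟨v, t, I, γ, hI, htI, hγ, hs, rfl⟩ := u
  change γ t ∈ e.source at hu
  have hγt : MDifferentiableAt 𝓘(ℝ, ℝ) 𝓘(ℝ, BaseModel n) γ t :=
    (hγ.contMDiffAt (hI.mem_nhds htI)).mdifferentiableAt (by simp)
  have het := he.mdifferentiable.mdifferentiableAt hu
  have h1 := mfderiv_comp t het hγt
  have h2 : DifferentiableAt ℝ (e ∘ γ) t :=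
    (mdifferentiableAt_iff_differentiableAt).1 (het.comp t hγt)
  have h3 : HasFDerivAt (fun s => ((e ∘ γ) s).1)
      ((ContinuousLinearMap.fst ℝ ℝ _).comp (fderiv ℝ (e ∘ γ) t)) t :=
    (hasFDerivAt_fst).comp t h2.hasFDerivAt
  have h4 : (fun s => ((e ∘ γ) s).1) =ᶠ[𝓝 t] id := by
    have : ∀ᶠ s in 𝓝 t, γ s ∈ e.source :=
      hγt.continuousAt.eventually (e.open_source.mem_nhds hu)
    filter_upwards [this, hI.mem_nhds htI] with s h5 h6
    simp only [Function.comp_apply, id]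
    rw [he.2 _ h5, hs s h6]
  have h5 := (h3.congr_of_eventuallyEq h4.symm).unique (hasFDerivAt_id t)
  have h6 := congrArg (fun f : ℝ →L[ℝ] ℝ => f 1) h5
  have h7 : (fderiv ℝ (e ∘ γ) t) 1 = (mfderiv 𝓘(ℝ, BaseModel n) 𝓘(ℝ, BaseModel n) e (γ t))
      (mfderiv 𝓘(ℝ, ℝ) 𝓘(ℝ, BaseModel n) γ t (1 : ℝ)) := by
    rw [← mfderiv_eq_fderiv, h1]; rfl
  simp only [ContinuousLinearMap.comp_apply, ContinuousLinearMap.coe_fst'] at h6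
  rw [h7] at h6
  exact h6

/-- The jet with coordinates `((t, x), y)`: it is represented by the section which in the chart `e`
is the straight line through `(t, x)` with velocity `(1, y)`. -/
theorem isFirstJet_of_coord {e : OpenPartialHomeomorph M (BaseModel n)} (he : IsFibredChart π e)
    {z : JetModel n} (hz : z.1 ∈ e.target) :
    IsFirstJet π ⟨e.symm z.1, mfderiv 𝓘(ℝ, BaseModel n) 𝓘(ℝ, BaseModel n) e.symm z.1
      ((NormedSpace.fromTangentSpace z.1).symm (1, z.2))⟩ := by
  let c : ℝ → BaseModel n := fun s => z.1 + (s - z.1.1) • ((1 : ℝ), z.2)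
  have hc : ContDiff ℝ ∞ c := by fun_prop
  have hct : c z.1.1 = z.1 := by simp [c]
  have hc1 : ∀ s, (c s).1 = s := by intro s; simp [c]
  have hcd : HasFDerivAt c ((ContinuousLinearMap.id ℝ ℝ).smulRight ((1 : ℝ), z.2)) z.1.1 := by
    have h1 : HasFDerivAt (fun s : ℝ => s - z.1.1) (ContinuousLinearMap.id ℝ ℝ) z.1.1 :=
      (hasFDerivAt_id _).sub_const _
    exact (h1.smul_const ((1 : ℝ), z.2)).const_add z.1
  have hz' : c z.1.1 ∈ e.target := by rw [hct]; exact hz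
  refine ⟨z.1.1, c ⁻¹' e.target, e.symm ∘ c, e.open_target.preimage hc.continuous, hz', ?_, ?_, ?_⟩
  · exact he.contMDiffOn_symm.comp hc.contMDiff.contMDiffOn fun s hs => hs
  · intro s hs
    rw [Function.comp_apply, ← he.2 _ (e.map_target hs), e.right_inv hs, hc1]
  · have hcm : MDifferentiableAt 𝓘(ℝ, ℝ) 𝓘(ℝ, BaseModel n) c z.1.1 :=
      hcd.differentiableAt.mdifferentiableAt
    have h1 := mfderiv_comp z.1.1 (he.mdifferentiable.mdifferentiableAt_symm hz') hcm
    rw [h1, mfderiv_eq_fderiv, hcd.fderiv]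
    have h2 : (⟨c z.1.1, ((1 : ℝ), z.2)⟩ : TangentBundle 𝓘(ℝ, BaseModel n) (BaseModel n))
        = ⟨z.1, ((1 : ℝ), z.2)⟩ := by rw [hct]
    have h3 := congrArg (tangentMap 𝓘(ℝ, BaseModel n) 𝓘(ℝ, BaseModel n) e.symm) h2
    refine h3.symm.trans ?_
    change (⟨e.symm (c z.1.1), _⟩ : TangentBundle 𝓘(ℝ, BaseModel n) M) = ⟨e.symm (c z.1.1), _⟩
    congr 1
    change _ = (mfderiv 𝓘(ℝ, BaseModel n) 𝓘(ℝ, BaseModel n) e.symm (c z.1.1))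
      ((1 : ℝ) • ((1 : ℝ), z.2))
    rw [one_smul]

theorem nonempty_jet (π : FibredOverReal n M) : Nonempty (Jet π) := by
  obtain ⟨p, -⟩ := π.surjective 0
  obtain ⟨e, he, hp⟩ := exists_isFibredChart π p
  exact ⟨⟨_, isFirstJet_of_coord (z := (e p, 0)) he (e.map_source hp)⟩⟩

/-- The coordinates `((t, x), y)` of a jet in a fibred chart `e`. -/
def jetCoord (e : OpenPartialHomeomorph M (BaseModel n)) (u : Jet π) : JetModel n :=
  (e u.base, (mvfderiv 𝓘(ℝ, BaseModel n) e u.base u.vel).2)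

open Classical in
/-- The jet with given coordinates `((t, x), y)` in a fibred chart `e`. -/
def jetOfCoord (e : OpenPartialHomeomorph M (BaseModel n)) (he : IsFibredChart π e)
    (z : JetModel n) : Jet π :=
  if hz : z.1 ∈ e.target then ⟨_, isFirstJet_of_coord he hz⟩
  else Classical.choice (nonempty_jet π)

theorem jetOfCoord_of_mem {e : OpenPartialHomeomorph M (BaseModel n)} (he : IsFibredChart π e)
    {z : JetModel n} (hz : z.1 ∈ e.target) :
    jetOfCoord e he z = ⟨_, isFirstJet_of_coord he hz⟩ := dif_pos hz

theorem jetOfCoord_base {e : OpenPartialHomeomorph M (BaseModel n)} (he : IsFibredChart π e)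
    {z : JetModel n} (hz : z.1 ∈ e.target) : (jetOfCoord e he z).base = e.symm z.1 := by
  rw [jetOfCoord_of_mem he hz]; rfl

theorem Jet.continuous_base : Continuous (Jet.base : Jet π → M) :=
  (FiberBundle.continuous_proj _ _).comp continuous_subtype_val

/-- The chart `((t, x), y)` of `J¹π` induced by a fibred chart `(t, x)` of `M`. -/
def jetChart (e : OpenPartialHomeomorph M (BaseModel n)) (he : IsFibredChart π e) :
    OpenPartialHomeomorph (Jet π) (JetModel n) where
  toFun := jetCoord e
  invFun := jetOfCoord e he
  source := Jet.base ⁻¹' e.source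
  target := Prod.fst ⁻¹' e.target
  map_source' u hu := e.map_source hu
  map_target' z hz := by
    rw [Set.mem_preimage, jetOfCoord_base he hz]
    exact e.map_target hz
  left_inv' u hu := by
    have hz : (jetCoord e u).1 ∈ e.target := e.map_source hu
    have h1 : ((1 : ℝ), (jetCoord e u).2) =
        mfderiv 𝓘(ℝ, BaseModel n) 𝓘(ℝ, BaseModel n) e u.base u.vel :=
      Prod.ext (Jet.vel_fst he u hu).symm rfl
    have h2 := congrArg (fun f => f u.vel) (he.mdifferentiable.symm_comp_deriv hu)
    have h3 : mfderiv 𝓘(ℝ, BaseModel n) 𝓘(ℝ, BaseModel n) e.symm (e u.base)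
        (mfderiv 𝓘(ℝ, BaseModel n) 𝓘(ℝ, BaseModel n) e u.base u.vel) = u.vel := h2
    rw [← h1] at h3
    refine (jetOfCoord_of_mem he hz).trans (Subtype.ext ?_)
    exact Bundle.TotalSpace.ext (e.left_inv hu) (heq_of_eq h3)
  right_inv' z hz := by
    have h1 := congrArg (fun f => f ((1 : ℝ), z.2)) (he.mdifferentiable.comp_symm_deriv hz)
    rw [jetOfCoord_of_mem he hz]
    exact Prod.ext (e.right_inv hz) (congrArg (fun w : BaseModel n => w.2) h1)
  open_source := e.open_source.preimage Jet.continuous_base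
  open_target := e.open_target.preimage continuous_fst
  continuousOn_toFun := by
    refine ContinuousOn.prodMk (e.continuousOn.comp Jet.continuous_base.continuousOn fun u hu => hu)
      ?_
    have h1 := he.contMDiffOn.continuousOn_tangentMapWithin (by simp) e.open_source.uniqueMDiffOn
    have h2 := (tangentBundleModelSpaceHomeomorph 𝓘(ℝ, BaseModel n)).continuous.comp_continuousOn h1
    have h3 : ContinuousOn (fun u : Jet π => ((tangentBundleModelSpaceHomeomorph 𝓘(ℝ, BaseModel n))
        (tangentMapWithin 𝓘(ℝ, BaseModel n) 𝓘(ℝ, BaseModel n) e e.source u.1)).2.2)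
        (Jet.base ⁻¹' e.source) :=
      continuous_snd.comp_continuousOn (continuous_snd.comp_continuousOn
        (h2.comp continuous_subtype_val.continuousOn fun u hu => hu))
    refine h3.congr fun u hu => ?_
    have h4 := mfderivWithin_of_isOpen (I := 𝓘(ℝ, BaseModel n)) (I' := 𝓘(ℝ, BaseModel n))
      (f := e) e.open_source hu
    exact (congrArg (fun f : BaseModel n →L[ℝ] BaseModel n => (f u.vel).2) h4).symm
  continuousOn_invFun := by
    have h1 := he.contMDiffOn_symm.continuousOn_tangentMapWithin (by simp)
      e.open_target.uniqueMDiffOn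
    have h2 : Continuous fun z : JetModel n =>
        (tangentBundleModelSpaceHomeomorph 𝓘(ℝ, BaseModel n)).symm (z.1, ((1 : ℝ), z.2)) := by
      refine (Homeomorph.continuous _).comp ?_
      exact continuous_fst.prodMk (continuous_const.prodMk continuous_snd)
    have h3 := h1.comp (h2.continuousOn (s := Prod.fst ⁻¹' e.target)) fun z hz => hz
    refine Topology.IsInducing.subtypeVal.continuousOn_iff.2 (h3.congr fun z hz => ?_)
    have h4 := mfderivWithin_of_isOpen (I := 𝓘(ℝ, BaseModel n)) (I' := 𝓘(ℝ, BaseModel n))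
      (f := e.symm) e.open_target hz
    refine (congrArg Subtype.val (jetOfCoord_of_mem he hz)).trans ?_
    exact Bundle.TotalSpace.ext rfl (heq_of_eq
      (congrArg (fun f : BaseModel n →L[ℝ] BaseModel n => f ((1 : ℝ), z.2)) h4).symm)

instance : ChartedSpace (JetModel n) (Jet π) where
  atlas := {φ | ∃ e, ∃ he : IsFibredChart π e, φ = jetChart e he}
  chartAt u := jetChart (exists_isFibredChart π (Jet.base u)).choose
    (exists_isFibredChart π u.base).choose_spec.1
  mem_chart_source u := (exists_isFibredChart π u.base).choose_spec.2
  chart_mem_atlas _ := ⟨_, _, rfl⟩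

/-- The first prolongation `(x, y) ↦ (g x, Dg x (1, y))` of a change of fibred coordinates. -/
def prolong (g : BaseModel n → BaseModel n) (z : JetModel n) : JetModel n :=
  (g z.1, (fderiv ℝ g z.1 (1, z.2)).2)

theorem contDiffOn_transition {e e' : OpenPartialHomeomorph M (BaseModel n)}
    (he : IsFibredChart π e) (he' : IsFibredChart π e') :
    ContDiffOn ℝ ∞ (e' ∘ e.symm) (e.target ∩ e.symm ⁻¹' e'.source) :=
  (he'.contMDiffOn.comp (he.contMDiffOn_symm.mono Set.inter_subset_left)
    fun _ hz => hz.2).contDiffOn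

theorem isOpen_transition (e e' : OpenPartialHomeomorph M (BaseModel n)) :
    IsOpen (e.target ∩ e.symm ⁻¹' e'.source) :=
  e.symm.isOpen_inter_preimage e'.open_source

theorem contDiffOn_prolong {g : BaseModel n → BaseModel n} {s : Set (BaseModel n)}
    (hs : IsOpen s) (hg : ContDiffOn ℝ ∞ g s) :
    ContDiffOn ℝ ∞ (prolong g) (Prod.fst ⁻¹' s) := by
  have h1 : ContDiffOn ℝ ∞ (fun z : JetModel n => g z.1) (Prod.fst ⁻¹' s) :=
    hg.comp contDiff_fst.contDiffOn fun z hz => hz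
  have h2 : ContDiffOn ℝ ∞ (fun z : JetModel n => fderiv ℝ g z.1) (Prod.fst ⁻¹' s) :=
    (hg.fderiv_of_isOpen hs (by simp)).comp contDiff_fst.contDiffOn fun z hz => hz
  exact h1.prodMk (contDiff_snd.comp_contDiffOn
    (h2.clm_apply (contDiff_const.prodMk contDiff_snd).contDiffOn))

theorem jetCoord_jetOfCoord {e e' : OpenPartialHomeomorph M (BaseModel n)}
    (he : IsFibredChart π e) (he' : IsFibredChart π e') {z : JetModel n}
    (hz : z.1 ∈ e.target ∩ e.symm ⁻¹' e'.source) :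
    jetCoord e' (jetOfCoord e he z) = prolong (e' ∘ e.symm) z := by
  rw [jetOfCoord_of_mem he hz.1]
  have h1 := mfderiv_comp z.1 (he'.mdifferentiable.mdifferentiableAt hz.2)
    (he.mdifferentiable.mdifferentiableAt_symm hz.1)
  rw [mfderiv_eq_fderiv] at h1
  refine Prod.ext rfl ?_
  exact (congrArg (fun f : BaseModel n →L[ℝ] BaseModel n => (f ((1 : ℝ), z.2)).2) h1).symm

instance : IsManifold 𝓘(ℝ, JetModel n) ∞ (Jet π) := by
  refine isManifold_of_contDiffOn _ _ _ ?_
  rintro _ _ ⟨e, he, rfl⟩ ⟨e', he', rfl⟩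
  have h1 := contDiffOn_prolong (isOpen_transition e e') (contDiffOn_transition he he')
  have h2 : ∀ z ∈ ((jetChart e he).symm.trans (jetChart e' he')).source,
      z.1 ∈ e.target ∩ e.symm ⁻¹' e'.source := by
    intro z hz
    have hz1 : z.1 ∈ e.target := hz.1
    refine ⟨hz1, ?_⟩
    have hz2 : (jetOfCoord e he z).base ∈ e'.source := hz.2
    rw [jetOfCoord_base he hz1] at hz2
    exact hz2
  exact (h1.mono fun z hz => h2 z hz.1).congr fun z hz =>
    jetCoord_jetOfCoord he he' (h2 z hz.1)

/-- The tensor `∂/∂yⁱ ⊗ δxⁱ`, `δxⁱ = dxⁱ - yⁱ dt`, at a point with fibre coordinates `y`. -/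
def modelJ (y : EuclideanSpace ℝ (Fin n)) : JetModel n →L[ℝ] JetModel n :=
  (ContinuousLinearMap.inr ℝ (BaseModel n) (EuclideanSpace ℝ (Fin n))).comp
    ((ContinuousLinearMap.snd ℝ ℝ (EuclideanSpace ℝ (Fin n)) -
      (ContinuousLinearMap.fst ℝ ℝ (EuclideanSpace ℝ (Fin n))).smulRight y).comp
        (ContinuousLinearMap.fst ℝ (BaseModel n) (EuclideanSpace ℝ (Fin n))))

variable (π) in
/-- The vertical endomorphism `J = ∂/∂yⁱ ⊗ δxⁱ`, written in the preferred induced chart at `u`;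
`vertEndo_eq` says that it has this expression in every induced chart. -/
def vertEndo : EndoField (JetModel n) (Jet π) := fun u =>
  (mvfderiv 𝓘(ℝ, JetModel n) (chartAt (JetModel n) u) u).inverse.comp
    ((modelJ (chartAt (JetModel n) u u).2).comp
      (mvfderiv 𝓘(ℝ, JetModel n) (chartAt (JetModel n) u) u))

theorem modelJ_apply (y : EuclideanSpace ℝ (Fin n)) (v : JetModel n) :
    modelJ y v = (0, v.1.2 - v.1.1 • y) := rfl

/-- `∂/∂yⁱ ⊗ δxⁱ` is invariant under prolonged changes of fibred coordinates. -/
theorem fderiv_prolong_modelJ {g : BaseModel n → BaseModel n} {s : Set (BaseModel n)}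
    (hs : IsOpen s) (hg : ContDiffOn ℝ ∞ g s) (hg1 : ∀ x ∈ s, (g x).1 = x.1) {z : JetModel n}
    (hz : z.1 ∈ s) :
    (fderiv ℝ (prolong g) z).comp (modelJ z.2) =
      (modelJ (prolong g z).2).comp (fderiv ℝ (prolong g) z) := by
  have hgd : HasFDerivAt g (fderiv ℝ g z.1) z.1 :=
    ((hg.contDiffAt (hs.mem_nhds hz)).differentiableAt (by simp)).hasFDerivAt
  have hgd2 : HasFDerivAt (fderiv ℝ g) (fderiv ℝ (fderiv ℝ g) z.1) z.1 :=
    (((hg.fderiv_of_isOpen hs (m := ∞) (by simp)).contDiffAt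
      (hs.mem_nhds hz)).differentiableAt (by simp)).hasFDerivAt
  have hfst : ∀ v, (fderiv ℝ g z.1 v).1 = v.1 := by
    intro v
    have h1 : HasFDerivAt (fun x => (g x).1)
        ((ContinuousLinearMap.fst ℝ ℝ _).comp (fderiv ℝ g z.1)) z.1 := hasFDerivAt_fst.comp z.1 hgd
    have h2 : (fun x => (g x).1) =ᶠ[𝓝 z.1] fun x => x.1 := by
      filter_upwards [hs.mem_nhds hz] with x hx using hg1 x hx
    have h3 := (h1.congr_of_eventuallyEq h2.symm).unique hasFDerivAt_fst
    exact congrArg (fun f : BaseModel n →L[ℝ] ℝ => f v) h3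
  have hp : HasFDerivAt (prolong g)
      (((fderiv ℝ g z.1).comp (ContinuousLinearMap.fst ℝ _ _)).prod
        ((ContinuousLinearMap.snd ℝ _ _).comp
          ((fderiv ℝ g z.1).comp ((0 : JetModel n →L[ℝ] ℝ).prod (ContinuousLinearMap.snd ℝ _ _)) +
            ((fderiv ℝ (fderiv ℝ g) z.1).comp (ContinuousLinearMap.fst ℝ _ _)).flip
              (1, z.2)))) z := by
    have h1 : HasFDerivAt (fun w : JetModel n => g w.1) _ z := hgd.comp z hasFDerivAt_fst
    have h2 : HasFDerivAt (fun w : JetModel n => fderiv ℝ g w.1) _ z :=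
      hgd2.comp z hasFDerivAt_fst
    have h0 : HasFDerivAt (fun w : JetModel n => w.2) (ContinuousLinearMap.snd ℝ _ _) z :=
      hasFDerivAt_snd
    have h3 : HasFDerivAt (fun w : JetModel n => ((1 : ℝ), w.2)) _ z :=
      (hasFDerivAt_const (1 : ℝ) z).prodMk h0
    exact h1.prodMk (hasFDerivAt_snd.comp z (h2.clm_apply h3))
  rw [hp.fderiv]
  refine ContinuousLinearMap.ext fun v => ?_
  have hsplit : fderiv ℝ g z.1 (0, v.1.2 - v.1.1 • z.2)
      = fderiv ℝ g z.1 v.1 - v.1.1 • fderiv ℝ g z.1 (1, z.2) := by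
    rw [← map_smul, ← map_sub]
    congr 1
    exact Prod.ext (by simp) (by simp)
  simp only [ContinuousLinearMap.comp_apply, modelJ_apply, ContinuousLinearMap.prod_apply,
    _root_.add_apply, ContinuousLinearMap.flip_apply, ContinuousLinearMap.coe_fst',
    ContinuousLinearMap.coe_snd', _root_.zero_apply, map_zero, add_zero, hsplit,
    hfst, prolong]
  rfl

theorem vertEndo_eq {e : OpenPartialHomeomorph M (BaseModel n)} (he : IsFibredChart π e)
    (u : Jet π) (hu : u.base ∈ e.source) :
    (mvfderiv 𝓘(ℝ, JetModel n) (jetChart e he) u).comp (vertEndo π u) =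
      (modelJ (jetCoord e u).2).comp (mvfderiv 𝓘(ℝ, JetModel n) (jetChart e he) u) := by
  obtain ⟨e₀, he₀, hφ⟩ : ∃ e₀, ∃ he₀ : IsFibredChart π e₀,
    chartAt (JetModel n) u = jetChart e₀ he₀ := ⟨_, _, rfl⟩
  have hu₀ : u ∈ (jetChart e₀ he₀).source := hφ ▸ mem_chart_source (JetModel n) u
  have hu₀' : u.base ∈ e₀.source := hu₀
  have hmd := mdifferentiable_chart (I := 𝓘(ℝ, JetModel n)) u
  rw [hφ] at hmd
  have hinv : (mvfderiv 𝓘(ℝ, JetModel n) (jetChart e₀ he₀) u).IsInvertible :=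
    ⟨hmd.mfderiv hu₀, rfl⟩
  have hs := isOpen_transition e₀ e
  have hg := contDiffOn_transition he₀ he
  have hz : (jetChart e₀ he₀ u).1 ∈ e₀.target ∩ e₀.symm ⁻¹' e.source := by
    refine ⟨e₀.map_source hu₀', ?_⟩
    change e₀.symm (e₀ u.base) ∈ e.source
    rwa [e₀.left_inv hu₀']
  have hloc : (jetChart e he : Jet π → JetModel n) =ᶠ[𝓝 u]
      prolong (e ∘ e₀.symm) ∘ jetChart e₀ he₀ := by
    filter_upwards [(jetChart e₀ he₀).open_source.mem_nhds hu₀,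
      (jetChart e he).open_source.mem_nhds hu] with w hw hw'
    have hwz : (jetChart e₀ he₀ w).1 ∈ e₀.target ∩ e₀.symm ⁻¹' e.source := by
      refine ⟨e₀.map_source hw, ?_⟩
      change e₀.symm (e₀ w.base) ∈ e.source
      rw [e₀.left_inv hw]; exact hw'
    refine Eq.trans ?_ (jetCoord_jetOfCoord he₀ he hwz)
    exact congrArg (jetCoord e) ((jetChart e₀ he₀).left_inv hw).symm
  have hd : DifferentiableAt ℝ (prolong (e ∘ e₀.symm)) (jetChart e₀ he₀ u) :=
    ((contDiffOn_prolong hs hg).contDiffAt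
      ((hs.preimage continuous_fst).mem_nhds hz)).differentiableAt (by simp)
  have hcomp : mvfderiv 𝓘(ℝ, JetModel n) (jetChart e he) u =
      (fderiv ℝ (prolong (e ∘ e₀.symm)) (jetChart e₀ he₀ u)).comp
        (mvfderiv 𝓘(ℝ, JetModel n) (jetChart e₀ he₀) u) := by
    have h1 := hloc.mfderiv_eq (I := 𝓘(ℝ, JetModel n)) (I' := 𝓘(ℝ, JetModel n))
    have h2 := mfderiv_comp u hd.mdifferentiableAt (hmd.mdifferentiableAt hu₀)
    rw [mfderiv_eq_fderiv] at h2
    exact h1.trans h2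
  have hval : jetCoord e u = prolong (e ∘ e₀.symm) (jetChart e₀ he₀ u) := hloc.self_of_nhds
  have hJ : vertEndo π u = (mvfderiv 𝓘(ℝ, JetModel n) (jetChart e₀ he₀) u).inverse.comp
      ((modelJ (jetChart e₀ he₀ u).2).comp
        (mvfderiv 𝓘(ℝ, JetModel n) (jetChart e₀ he₀) u)) := by
    rw [vertEndo, hφ]
  have hcore := fderiv_prolong_modelJ hs hg (fun x hx => by
    rw [Function.comp_apply, he.2 _ hx.2, ← he₀.2 _ (e₀.map_target hx.1), e₀.right_inv hx.1]) hz
  rw [hval, hJ, hcomp]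
  ext1 v
  have hself : ∀ w, mvfderiv 𝓘(ℝ, JetModel n) (jetChart e₀ he₀) u
      ((mvfderiv 𝓘(ℝ, JetModel n) (jetChart e₀ he₀) u).inverse w) = w := fun w =>
    hinv.self_apply_inverse w
  have := congrArg (fun f : JetModel n →L[ℝ] JetModel n =>
    f (mvfderiv 𝓘(ℝ, JetModel n) (jetChart e₀ he₀) u v)) hcore
  simp only [ContinuousLinearMap.comp_apply] at this ⊢
  rw [hself, this]

variable (π) in
/-- The `1`-form `dt` on `J¹π`, the differential of the global function `t = π ∘ π₁₀`. -/
def dt : CovectorField (JetModel n) (Jet π) := fun u =>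
  mvfderiv 𝓘(ℝ, JetModel n) (fun w : Jet π => π.proj w.base) u

/-- A form on `J¹π` is semi-basic if it vanishes whenever one of its arguments is vertical, i.e. is
in the kernel of the differential of `π₁₀`. -/
def IsSemiBasic {k : ℕ} (θ : FormField (JetModel n) (Jet π) k) : Prop :=
  ∀ (u : Jet π) (X : Fin k → TangentSpace 𝓘(ℝ, JetModel n) u) (i : Fin k),
    mfderiv 𝓘(ℝ, JetModel n) 𝓘(ℝ, BaseModel n) Jet.base u (X i) = 0 → θ u X = 0

end Jets

end JetForms

end

noncomputable section

namespace JetForms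

/-! ### Wedge products with a linear form -/

section Wedge

variable {T : Type*} [AddCommGroup T] [Module ℝ T] [TopologicalSpace T] {k : ℕ}

/-! Since some vector has `dt = 1`, wedging with `dt` remembers exactly the restriction of a form to
the kernel of `dt` (`wedgeOne_dt_eq_iff`). So both closedness and exactness modulo `dt` are
statements about arguments in that kernel. There, in an induced chart, the term `yⁱ dt` drops out
and `J` becomes the constant endomorphism `A = ∂/∂yⁱ ⊗ dxⁱ`. Hence `d_J` turns into `d_A β = Alt (Dβ
∘ A)`, which is `∑ᵢ dxⁱ ∧ ∂β/∂yⁱ` (`insertEndo_extDeriv_sub`, `extDAlong_vertEndo_apply`).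

Part (i) is then `d_A ∘ d_A = 0`, a consequence of the symmetry of second derivatives
(`extDerivAlong_extDerivAlong`), together with the fact that `d_A β` on the kernel depends only on
the restrictions of `β` to the kernel at nearby points.

For part (ii), a semi-basic form restricted to the kernel involves only the `dxⁱ`. On such forms
`d_A` is the de Rham differential in the fibre variable `y`, with `dxⁱ` written for `dyⁱ` and `(t,
x)` as parameters. Induced charts contain whole fibres `ℝⁿ`, which are star-shaped about `0`. So the
classical radial homotopy applies: for `β` of degree `m + 1`, integrate over `s` in `[0, 1]` the
contraction of `s ^ m • β (t, x, s y)` with `yⁱ ∂/∂xⁱ`. Closedness makes `d_A` of the integrand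
equal to the `s`-derivative of `s ^ (m + 1) • β (t, x, s y)` (`sum_fderiv_homotopyIntegrand`), and
integration returns `β` (`extDerivAlong_homotopyOp`). Smooth dependence on parameters is
`contDiffOn_parametric_integral`. -/

theorem wedgeOne_eq_of_eqOn_ker {α : T →L[ℝ] ℝ} {e : T} (he : α e = 1)
    {η η' : T [⋀^Fin k]→L[ℝ] ℝ} (h : ∀ v, (∀ i, α (v i) = 0) → η v = η' v) :
    wedgeOne η α = wedgeOne η' α := by
  ext v
  -- Each argument splits into a kernel part and a multiple of `e`. Multilinearity expands both
  -- sides over the set `s` of slots that receive the kernel part.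
  have hv : v = (fun i => v i - α (v i) • e) + fun i => α (v i) • e := by
    ext i; simp
  have hker : ∀ i, α (v i - α (v i) • e) = 0 := by intro i; simp [he]
  set w : Fin (k + 1) → T := fun i => v i - α (v i) • e with hw
  set r : Fin (k + 1) → T := fun i => α (v i) • e with hr
  rw [hv]
  change (wedgeOne η α).toMultilinearMap (w + r) = (wedgeOne η' α).toMultilinearMap (w + r)
  rw [MultilinearMap.map_add_univ, MultilinearMap.map_add_univ]
  refine Finset.sum_congr rfl fun s _ => ?_
  change wedgeOne η α (s.piecewise w r) = wedgeOne η' α (s.piecewise w r)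
  -- Two slots filled with multiples of `e` annihilate any alternating form.
  by_cases hs : ∃ i j, i ≠ j ∧ i ∉ s ∧ j ∉ s
  · obtain ⟨i, j, hij, hi, hj⟩ := hs
    have key : ∀ B : T [⋀^Fin (k + 1)]→L[ℝ] ℝ, B (s.piecewise w r) = 0 := by
      intro B
      have h1 : s.piecewise w r = Function.update (s.piecewise w r) i (α (v i) • e) := by
        exact (Function.update_eq_self_iff.2 (by simp [hi, hr])).symm
      rw [h1, B.map_update_smul]
      have h2 : Function.update (s.piecewise w r) i e =
          Function.update (Function.update (s.piecewise w r) i e) j (α (v j) • e) := by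
        exact (Function.update_eq_self_iff.2 (by simp [hj, hr, hij.symm])).symm
      rw [h2, B.map_update_smul]
      rw [B.map_eq_zero_of_eq (i := i) (j := j) _ (by simp [hij]) hij]
      simp
    rw [key, key]
  -- Now at most one slot lies outside `s`. In the expanded wedge, a term that feeds a slot of `s`
  -- to `α` vanishes; the other possible term has only kernel vectors left for `η` and `η'`.
  · push Not at hs
    rw [wedgeOne_apply, wedgeOne_apply]
    congr 1
    refine Finset.sum_congr rfl fun i _ => ?_
    by_cases hi : i ∈ s
    · simp [hi, hw, he]
    · rw [h]
      intro j
      have : i.succAbove j ∈ s := by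
        by_contra hj
        exact hj (hs i _ (Fin.succAbove_ne i j).symm hi)
      simp [Fin.removeNth, this, hw, he]

/-- Putting `e` in front of kernel vectors leaves a single term of the wedge, which recovers the
value of the form up to the sign `(-1) ^ k`. -/
theorem eqOn_ker_of_wedgeOne_eq {α : T →L[ℝ] ℝ} {e : T} (he : α e = 1)
    {η η' : T [⋀^Fin k]→L[ℝ] ℝ} (h : wedgeOne η α = wedgeOne η' α)
    {v : Fin k → T} (hv : ∀ i, α (v i) = 0) : η v = η' v := by
  have key : ∀ B : T [⋀^Fin k]→L[ℝ] ℝ, wedgeOne B α (Fin.cons e v) = (-1) ^ k * B v := by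
    intro B
    rw [wedgeOne_apply, Fin.sum_univ_succ]
    simp [he, hv, Fin.tail_cons]
  have h1 := congrArg (fun B => B (Fin.cons e v)) h
  simp only [key] at h1
  exact mul_left_cancel₀ (by simp) h1

theorem wedgeOne_zero (α : T →L[ℝ] ℝ) : wedgeOne (0 : T [⋀^Fin k]→L[ℝ] ℝ) α = 0 := by
  ext v; simp [wedgeOne_apply]

end Wedge

/-! ### Smoothness of families of alternating forms -/

section Smooth

variable {V : Type*} [NormedAddCommGroup V] [NormedSpace ℝ V] [FiniteDimensional ℝ V]
  {E : Type*} [NormedAddCommGroup E] [NormedSpace ℝ E] {k : ℕ}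

/-- In finite dimension a form is a linear function of its values on tuples of basis vectors, so
smoothness can be tested on one fixed tuple of arguments at a time. -/
theorem contDiffOn_iff_eval {f : E → V [⋀^Fin k]→L[ℝ] ℝ} {s : Set E} {m : WithTop ℕ∞} :
    ContDiffOn ℝ m f s ↔ ∀ v, ContDiffOn ℝ m (fun x => f x v) s := by
  constructor
  · intro h v
    exact (ContinuousAlternatingMap.apply ℝ V ℝ v).contDiff.comp_contDiffOn h
  · intro h
    let b := Module.finBasis ℝ V
    let ev : (V [⋀^Fin k]→L[ℝ] ℝ) →ₗ[ℝ] ((Fin k → Fin (Module.finrank ℝ V)) → ℝ) :=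
      { toFun := fun B σ => B fun i => b (σ i)
        map_add' := fun _ _ => rfl
        map_smul' := fun _ _ => rfl }
    have hinj : Function.Injective ev := fun B B' h => by
      have h1 : B.toMultilinearMap = B'.toMultilinearMap :=
        Module.Basis.ext_multilinear (fun _ => b) fun σ => congrFun h σ
      ext v
      exact congrArg (fun f => f v) h1
    obtain ⟨g, hg⟩ := ev.exists_leftInverse_of_injective (LinearMap.ker_eq_bot.2 hinj)
    have h1 : ContDiffOn ℝ m (fun x => ev (f x)) s := contDiffOn_pi.2 fun σ => h _
    have h2 := (LinearMap.toContinuousLinearMap g).contDiff.comp_contDiffOn h1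
    refine h2.congr fun x _ => ?_
    exact (congrArg (fun F => F (f x)) hg).symm

/-- Evaluation is analytic jointly in the form and its arguments, being linear in the former and
multilinear in the latter. -/
theorem _root_.ContDiffOn.alternating_apply {f : E → V [⋀^Fin k]→L[ℝ] ℝ} {w : E → Fin k → V} {s : Set E}
    {m : WithTop ℕ∞} (hf : ContDiffOn ℝ m f s) (hw : ∀ i, ContDiffOn ℝ m (fun x => w x i) s) :
    ContDiffOn ℝ m (fun x => f x (w x)) s := by
  let F := ContinuousAlternatingMap.toContinuousMultilinearMapCLM
    (𝕜 := ℝ) (E := V) (F := ℝ) (ι := Fin k) ℝ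
  have h1 : ContDiff ℝ m (fun p : (V [⋀^Fin k]→L[ℝ] ℝ) × (Fin k → V) => F p.1 p.2) := by
    rw [← contDiffOn_univ]
    exact F.analyticOnNhd_uncurry_of_multilinear.contDiffOn uniqueDiffOn_univ
  exact h1.comp_contDiffOn (hf.prodMk (contDiffOn_pi.2 hw))

theorem _root_.ContDiffOn.alternating_comp {f : E → V [⋀^Fin k]→L[ℝ] ℝ} {L : E → V →L[ℝ] V} {s : Set E}
    {m : WithTop ℕ∞} (hf : ContDiffOn ℝ m f s) (hL : ContDiffOn ℝ m L s) :
    ContDiffOn ℝ m (fun x => (f x).compContinuousLinearMap (L x)) s :=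
  contDiffOn_iff_eval.2 fun _ => hf.alternating_apply fun _ => hL.clm_apply contDiffOn_const

theorem _root_.ContDiffOn.insertEndo {f : E → V [⋀^Fin k]→L[ℝ] ℝ} {L : E → V →L[ℝ] V} {s : Set E}
    {m : WithTop ℕ∞} (hf : ContDiffOn ℝ m f s) (hL : ContDiffOn ℝ m L s) :
    ContDiffOn ℝ m (fun x => insertEndo (L x) (f x)) s := by
  refine contDiffOn_iff_eval.2 fun v => ?_
  simp only [insertEndo_apply]
  refine ContDiffOn.sum fun i _ => hf.alternating_apply fun j => ?_
  by_cases h : j = i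
  · subst h; simpa using hL.clm_apply contDiffOn_const
  · simpa [h] using contDiffOn_const

end Smooth

/-! ### The exterior derivative along a constant endomorphism -/

section Along

open ContinuousAlternatingMap

variable {V : Type*} [NormedAddCommGroup V] [NormedSpace ℝ V] {k : ℕ}

/-- The derivation `d_A` on forms of a normed space, for a constant endomorphism `A`. -/
def extDerivAlong (A : V →L[ℝ] V) (β : V → V [⋀^Fin k]→L[ℝ] ℝ) (x : V) :
    V [⋀^Fin (k + 1)]→L[ℝ] ℝ :=
  alternatizeUncurryFin ((fderiv ℝ β x).comp A)

theorem extDerivAlong_apply (A : V →L[ℝ] V) (β : V → V [⋀^Fin k]→L[ℝ] ℝ) (x : V)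
    (v : Fin (k + 1) → V) :
    extDerivAlong A β x v =
      ∑ i : Fin (k + 1), (-1 : ℤ) ^ (i : ℕ) • fderiv ℝ β x (A (v i)) (i.removeNth v) := by
  simp [extDerivAlong, ContinuousAlternatingMap.alternatizeUncurryFin_apply]

theorem fderiv_alternating_apply {β : V → V [⋀^Fin k]→L[ℝ] ℝ} {x : V}
    (h : DifferentiableAt ℝ β x) (v : Fin k → V) (w : V) :
    fderiv ℝ (fun z => β z v) x w = fderiv ℝ β x w v := by
  have := (ContinuousAlternatingMap.apply ℝ V ℝ v).hasFDerivAt.comp x h.hasFDerivAt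
  exact congrArg (fun f => f w) this.fderiv

/-- `d_A β` restricted to an invariant subspace only depends on the restriction of `β`. -/
theorem extDerivAlong_congr {A : V →L[ℝ] V} {α : V →L[ℝ] ℝ}
    {β β' : V → V [⋀^Fin k]→L[ℝ] ℝ} {x : V} (h : DifferentiableAt ℝ β x)
    (h' : DifferentiableAt ℝ β' x)
    (heq : ∀ᶠ z in 𝓝 x, ∀ v, (∀ i, α (v i) = 0) → β z v = β' z v)
    {v : Fin (k + 1) → V} (hv : ∀ i, α (v i) = 0) :
    extDerivAlong A β x v = extDerivAlong A β' x v := by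
  rw [extDerivAlong_apply, extDerivAlong_apply]
  refine Finset.sum_congr rfl fun i _ => ?_
  -- With the arguments frozen in the kernel, the two scalar functions agree on a full
  -- neighbourhood, so their derivatives agree in every direction, in particular `A (v i)`.
  rw [← fderiv_alternating_apply h, ← fderiv_alternating_apply h']
  congr 2
  refine Filter.EventuallyEq.fderiv_eq ?_
  filter_upwards [heq] with z hz using hz _ fun j => hv _

theorem hasFDerivAt_extDerivAlong {A : V →L[ℝ] V} {β : V → V [⋀^Fin k]→L[ℝ] ℝ} {x : V}
    (h : ContDiffAt ℝ 2 β x) :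
    HasFDerivAt (extDerivAlong A β) ((alternatizeUncurryFinCLM ℝ V ℝ).comp
      (((ContinuousLinearMap.compL ℝ V V (V [⋀^Fin k]→L[ℝ] ℝ)).flip A).comp
        (fderiv ℝ (fderiv ℝ β) x))) x := by
  have hd : DifferentiableAt ℝ (fderiv ℝ β) x :=
    (h.fderiv_right (m := 1) (by norm_num)).differentiableAt (by simp)
  have h1 := hd.hasFDerivAt.clm_comp (hasFDerivAt_const A x)
  have h2 := (alternatizeUncurryFinCLM ℝ V ℝ).hasFDerivAt.comp x h1
  refine h2.congr_fderiv ?_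
  ext
  simp

/-- Because `A` is constant, the square is the double alternation of `(v, w) ↦ D²β (A v, A w)`. This
is symmetric in `v` and `w`, so its alternation is zero. -/
theorem extDerivAlong_extDerivAlong {A : V →L[ℝ] V} {β : V → V [⋀^Fin k]→L[ℝ] ℝ} {x : V}
    (h : ContDiffAt ℝ 2 β x) : extDerivAlong A (extDerivAlong A β) x = 0 := by
  have hsymm : IsSymmSndFDerivAt ℝ β x := h.isSymmSndFDerivAt (by simp)
  rw [extDerivAlong, (hasFDerivAt_extDerivAlong h).fderiv]
  change alternatizeUncurryFin ((alternatizeUncurryFinCLM ℝ V ℝ).comp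
    ((((ContinuousLinearMap.compL ℝ V V (V [⋀^Fin k]→L[ℝ] ℝ)).flip A).comp
      (fderiv ℝ (fderiv ℝ β) x)).comp A)) = 0
  refine alternatizeUncurryFin_alternatizeUncurryFinCLM_comp_of_symmetric fun v w => ?_
  exact hsymm.eq (A v) (A w)

/-- On the kernel of `α`, where the endomorphism field `J` is equal to the constant endomorphism
`A`, the derivations `d_J` and `d_A` agree. -/
theorem insertEndo_extDeriv_sub {A : V →L[ℝ] V} {α : V →L[ℝ] ℝ} {J : V → V →L[ℝ] V}
    (hJ : ∀ z v, α v = 0 → J z v = A v) {β : V → V [⋀^Fin k]→L[ℝ] ℝ} {x : V}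
    (h : DifferentiableAt ℝ β x) (h' : DifferentiableAt ℝ (fun z => insertEndo (J z) (β z)) x)
    {v : Fin (k + 1) → V} (hv : ∀ i, α (v i) = 0) :
    insertEndo (J x) (extDeriv β x) v - extDeriv (fun z => insertEndo (J z) (β z)) x v =
      extDerivAlong A β x v := by
  have h1 : ∀ i : Fin (k + 1), fderiv ℝ (fun z => insertEndo (J z) (β z) (i.removeNth v)) x (v i) =
      ∑ l : Fin k, fderiv ℝ β x (v i) (Function.update (i.removeNth v) l (A (i.removeNth v l))) := by
    intro i
    -- On kernel vectors `J z` is `A` for every `z`, so no derivative of `J` appears.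
    have h2 : (fun z => insertEndo (J z) (β z) (i.removeNth v)) = fun z =>
        ∑ l : Fin k, β z (Function.update (i.removeNth v) l (A (i.removeNth v l))) := by
      funext z
      rw [insertEndo_apply]
      exact Finset.sum_congr rfl fun l _ => by rw [hJ z (i.removeNth v l) (hv _)]
    rw [h2, fderiv_fun_sum]
    · simp only [_root_.sum_apply]
      exact Finset.sum_congr rfl fun l _ => fderiv_alternating_apply h _ _
    · intro l _
      exact (ContinuousAlternatingMap.apply ℝ V ℝ _).differentiableAt.comp x h
  rw [extDeriv_apply h', extDerivAlong_apply, insertEndo_apply]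
  simp only [h1, hJ _ _ (hv _), extDeriv_apply h, fderiv_alternating_apply h]
  -- Both terms are double sums over the slot that gives the direction of differentiation and the
  -- slot hit by `A`. Off-diagonal terms cancel; the diagonal ones, which occur only in `i_J dβ`,
  -- form `d_A β`.
  rw [Finset.sum_comm, ← Finset.sum_sub_distrib]
  refine Finset.sum_congr rfl fun i _ => ?_
  rw [Fin.sum_univ_succAbove _ i]
  simp only [Function.update_self, Fin.removeNth_update, Finset.smul_sum]
  rw [add_sub_assoc, add_eq_left, sub_eq_zero]
  refine Finset.sum_congr rfl fun l _ => ?_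
  rw [Fin.removeNth_update_succAbove, Function.update_of_ne (Fin.succAbove_ne i l).symm]
  rfl

end Along

end JetForms

end

noncomputable section

namespace JetForms

/-! ### Integrals depending smoothly on parameters -/

section Parametric

universe u

/-- The partial derivative is continuous, hence bounded on a closed ball times `[0, 1]`; a constant
bound is enough to differentiate under the integral by domination. -/
theorem hasFDerivAt_parametric_integral {E G : Type*} [NormedAddCommGroup E] [NormedSpace ℝ E]
    [FiniteDimensional ℝ E] [NormedAddCommGroup G] [NormedSpace ℝ G]
    {U : Set E} (hU : IsOpen U) {f : E × ℝ → G} (hf : ContDiffOn ℝ 1 f (U ×ˢ Set.univ))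
    {z : E} (hz : z ∈ U) :
    HasFDerivAt (fun x => ∫ s in (0 : ℝ)..1, f (x, s))
      (∫ s in (0 : ℝ)..1, (fderiv ℝ f (z, s)).comp (ContinuousLinearMap.inl ℝ E ℝ)) z := by
  have hopen : IsOpen (U ×ˢ (Set.univ : Set ℝ)) := hU.prod isOpen_univ
  have hfc : ∀ x ∈ U, Continuous fun s : ℝ => f (x, s) := fun x hx =>
    hf.continuousOn.comp_continuous (by fun_prop) fun s => ⟨hx, trivial⟩
  have hD : ContinuousOn (fun p => (fderiv ℝ f p).comp (ContinuousLinearMap.inl ℝ E ℝ))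
      (U ×ˢ Set.univ) :=
    (hf.continuousOn_fderiv_of_isOpen hopen le_rfl).clm_comp continuousOn_const
  have hDc : Continuous fun s : ℝ => (fderiv ℝ f (z, s)).comp (ContinuousLinearMap.inl ℝ E ℝ) :=
    hD.comp_continuous (by fun_prop) fun s => ⟨hz, trivial⟩
  obtain ⟨r, hr, hrU⟩ := Metric.nhds_basis_closedBall.mem_iff.1 (hU.mem_nhds hz)
  have hK : IsCompact (Metric.closedBall z r ×ˢ Set.uIcc (0 : ℝ) 1) :=
    (isCompact_closedBall z r).prod isCompact_uIcc
  obtain ⟨C, hC⟩ := hK.exists_bound_of_continuousOn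
    (hD.mono (Set.prod_mono hrU (Set.subset_univ _)))
  refine intervalIntegral.hasFDerivAt_integral_of_dominated_of_fderiv_le
    (F := fun x s => f (x, s))
    (F' := fun x s => (fderiv ℝ f (x, s)).comp (ContinuousLinearMap.inl ℝ E ℝ))
    (bound := fun _ => C) (Metric.closedBall_mem_nhds z hr) ?_ ?_ ?_ ?_ ?_ ?_
  · filter_upwards [hU.mem_nhds hz] with x hx
    exact (hfc x hx).aestronglyMeasurable
  · exact (hfc z hz).intervalIntegrable _ _
  · exact hDc.aestronglyMeasurable
  · exact Filter.Eventually.of_forall fun s hs x hx => hC (x, s) ⟨hx, Set.uIoc_subset_uIcc hs⟩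
  · exact intervalIntegrable_const
  · refine Filter.Eventually.of_forall fun s _ x hx => ?_
    have h1 : DifferentiableAt ℝ f (x, s) :=
      (hf.contDiffAt (hopen.mem_nhds ⟨hrU hx, trivial⟩)).differentiableAt (by simp)
    exact HasFDerivAt.comp (g := f) (f := fun y => (y, s)) x h1.hasFDerivAt
      (hasFDerivAt_prodMk_left x s)

theorem continuous_fderiv_slice_apply {E G : Type*} [NormedAddCommGroup E] [NormedSpace ℝ E]
    [NormedAddCommGroup G] [NormedSpace ℝ G]
    {U : Set E} (hU : IsOpen U) {f : E × ℝ → G} (hf : ContDiffOn ℝ 1 f (U ×ˢ Set.univ))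
    {z : E} (hz : z ∈ U) (w : E) (l : G →L[ℝ] ℝ) :
    Continuous fun s : ℝ => l (fderiv ℝ f (z, s) (w, 0)) := by
  have h1 : ContinuousOn (fun p => l (fderiv ℝ f p (w, 0))) (U ×ˢ Set.univ) :=
    l.continuous.comp_continuousOn
      ((hf.continuousOn_fderiv_of_isOpen (hU.prod isOpen_univ) le_rfl).clm_apply continuousOn_const)
  exact h1.comp_continuous (by fun_prop) fun s => ⟨hz, trivial⟩

theorem fderiv_parametric_integral_apply {E G : Type*} [NormedAddCommGroup E] [NormedSpace ℝ E]
    [FiniteDimensional ℝ E] [NormedAddCommGroup G] [NormedSpace ℝ G] [CompleteSpace G]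
    {U : Set E} (hU : IsOpen U) {f : E × ℝ → G} (hf : ContDiffOn ℝ 1 f (U ×ˢ Set.univ))
    {z : E} (hz : z ∈ U) (w : E) (l : G →L[ℝ] ℝ) :
    l (fderiv ℝ (fun x => ∫ s in (0 : ℝ)..1, f (x, s)) z w) =
      ∫ s in (0 : ℝ)..1, l (fderiv ℝ f (z, s) (w, 0)) := by
  have hD : ContinuousOn (fun p => (fderiv ℝ f p).comp (ContinuousLinearMap.inl ℝ E ℝ))
      (U ×ˢ Set.univ) :=
    (hf.continuousOn_fderiv_of_isOpen (hU.prod isOpen_univ) le_rfl).clm_comp continuousOn_const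
  have hDc : Continuous fun s : ℝ => (fderiv ℝ f (z, s)).comp (ContinuousLinearMap.inl ℝ E ℝ) :=
    hD.comp_continuous (by fun_prop) fun s => ⟨hz, trivial⟩
  rw [(hasFDerivAt_parametric_integral hU hf hz).fderiv]
  exact ((l.comp (ContinuousLinearMap.apply ℝ G w)).intervalIntegral_comp_comm
    (hDc.intervalIntegrable 0 1)).symm

/-- The derivative of the integral is again a parametric integral, now with values in `E →L[ℝ] G`.
The induction therefore ranges over all target spaces, and `E` and `G` share a universe so that this
new target is admissible. -/
theorem contDiffOn_parametric_integral_nat {E : Type u} [NormedAddCommGroup E] [NormedSpace ℝ E]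
    [FiniteDimensional ℝ E] {U : Set E} (hU : IsOpen U) (m : ℕ) :
    ∀ {G : Type u} [NormedAddCommGroup G] [NormedSpace ℝ G]
      {f : E × ℝ → G}, ContDiffOn ℝ ∞ f (U ×ˢ Set.univ) →
      ContDiffOn ℝ m (fun x => ∫ s in (0 : ℝ)..1, f (x, s)) U := by
  induction m with
  | zero =>
    intro G _ _ f hf
    refine contDiffOn_zero.2 fun x hx => ?_
    exact (hasFDerivAt_parametric_integral hU (hf.of_le (by simp)) hx).continuousAt.continuousWithinAt
  | succ m ih =>
    intro G _ _ f hf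
    have hopen : IsOpen (U ×ˢ (Set.univ : Set ℝ)) := hU.prod isOpen_univ
    have hder := fun x (hx : x ∈ U) =>
      hasFDerivAt_parametric_integral hU (hf.of_le (by simp)) hx
    push_cast
    rw [contDiffOn_succ_iff_fderiv_of_isOpen hU]
    refine ⟨fun x hx => (hder x hx).differentiableAt.differentiableWithinAt, by simp, ?_⟩
    have h1 : ContDiffOn ℝ ∞ (fun p => (fderiv ℝ f p).comp (ContinuousLinearMap.inl ℝ E ℝ))
        (U ×ˢ Set.univ) :=
      (hf.fderiv_of_isOpen hopen (by simp)).clm_comp contDiffOn_const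
    exact (ih h1).congr fun x hx => (hder x hx).fderiv

theorem contDiffOn_parametric_integral {E G : Type u} [NormedAddCommGroup E] [NormedSpace ℝ E]
    [FiniteDimensional ℝ E] [NormedAddCommGroup G] [NormedSpace ℝ G]
    {U : Set E} (hU : IsOpen U) {f : E × ℝ → G} (hf : ContDiffOn ℝ ∞ f (U ×ˢ Set.univ)) :
    ContDiffOn ℝ ∞ (fun x => ∫ s in (0 : ℝ)..1, f (x, s)) U :=
  contDiffOn_infty.2 fun m => contDiffOn_parametric_integral_nat hU m hf

end Parametric

/-! ### The fibrewise Poincaré lemma on the space of coordinates -/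

section Model

open ContinuousAlternatingMap

variable {n : ℕ}

variable (n) in
/-- The constant endomorphism `∂/∂yⁱ ⊗ dxⁱ`. -/
def vertA : JetModel n →L[ℝ] JetModel n :=
  (ContinuousLinearMap.inr ℝ (BaseModel n) (EuclideanSpace ℝ (Fin n))).comp
    ((ContinuousLinearMap.snd ℝ ℝ (EuclideanSpace ℝ (Fin n))).comp
      (ContinuousLinearMap.fst ℝ (BaseModel n) (EuclideanSpace ℝ (Fin n))))

variable (n) in
/-- The projection onto the `x`-directions. -/
def horProj : JetModel n →L[ℝ] JetModel n :=
  (ContinuousLinearMap.inl ℝ (BaseModel n) (EuclideanSpace ℝ (Fin n))).comp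
    ((ContinuousLinearMap.inr ℝ ℝ (EuclideanSpace ℝ (Fin n))).comp
      ((ContinuousLinearMap.snd ℝ ℝ (EuclideanSpace ℝ (Fin n))).comp
        (ContinuousLinearMap.fst ℝ (BaseModel n) (EuclideanSpace ℝ (Fin n)))))

variable (n) in
/-- The linear map `((t, x), y) ↦ ((0, y), 0)`. -/
def horLift : JetModel n →L[ℝ] JetModel n :=
  (ContinuousLinearMap.inl ℝ (BaseModel n) (EuclideanSpace ℝ (Fin n))).comp
    ((ContinuousLinearMap.inr ℝ ℝ (EuclideanSpace ℝ (Fin n))).comp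
      (ContinuousLinearMap.snd ℝ (BaseModel n) (EuclideanSpace ℝ (Fin n))))

variable (n) in
/-- The coordinate form `dt`. -/
def modelDt : JetModel n →L[ℝ] ℝ :=
  (ContinuousLinearMap.fst ℝ ℝ (EuclideanSpace ℝ (Fin n))).comp
    (ContinuousLinearMap.fst ℝ (BaseModel n) (EuclideanSpace ℝ (Fin n)))

theorem vertA_apply (v : JetModel n) : vertA n v = (0, v.1.2) := rfl

theorem horProj_apply (v : JetModel n) : horProj n v = ((0, v.1.2), 0) := rfl

theorem modelDt_apply (v : JetModel n) : modelDt n v = v.1.1 := rfl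

theorem modelJ_eq_vertA (y : EuclideanSpace ℝ (Fin n)) {v : JetModel n} (hv : modelDt n v = 0) :
    modelJ y v = vertA n v := by
  rw [modelDt_apply] at hv
  simp [modelJ_apply, vertA_apply, hv]

/-- On the kernel of `dt` a semi-basic form only depends on the `x`-components. -/
theorem comp_horProj_of_semibasic {k : ℕ} {B : JetModel n [⋀^Fin k]→L[ℝ] ℝ}
    (hB : ∀ (v : Fin k → JetModel n) (i : Fin k), (v i).1 = 0 → B v = 0)
    {v : Fin k → JetModel n} (hv : ∀ i, modelDt n (v i) = 0) :
    B (fun i => horProj n (v i)) = B v := by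
  have h1 : v = (fun i => horProj n (v i)) + fun i => ((0, (v i).2) : JetModel n) := by
    funext i
    have := hv i
    rw [modelDt_apply] at this
    refine Prod.ext (Prod.ext ?_ ?_) ?_ <;> simp [horProj_apply, this]
  conv_rhs => rw [h1]
  change _ = B.toMultilinearMap (_ + _)
  rw [MultilinearMap.map_add_univ, Finset.sum_eq_single Finset.univ]
  · simp
  · intro s _ hs
    obtain ⟨i, hi⟩ : ∃ i, i ∉ s := by
      by_contra! h
      exact hs (Finset.eq_univ_iff_forall.2 h)
    exact hB _ i (by simp [hi])
  · simp

/-- The linear map `((t, x), y) ↦ ((t, x), s y)`. -/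
def fibreScale (s : ℝ) : JetModel n →L[ℝ] JetModel n :=
  (ContinuousLinearMap.fst ℝ (BaseModel n) (EuclideanSpace ℝ (Fin n))).prod
    (s • ContinuousLinearMap.snd ℝ (BaseModel n) (EuclideanSpace ℝ (Fin n)))

theorem fibreScale_apply (s : ℝ) (z : JetModel n) : fibreScale s z = (z.1, s • z.2) := rfl

variable {m : ℕ} {W : Set (BaseModel n)}

theorem _root_.HasFDerivAt.linearIsometry_comp {E F G : Type*} [NormedAddCommGroup E]
    [NormedSpace ℝ E] [NormedAddCommGroup F] [NormedSpace ℝ F] [NormedAddCommGroup G]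
    [NormedSpace ℝ G] (L : F →ₗᵢ[ℝ] G) {f : E → F} {f' : E →L[ℝ] F} {x : E}
    (hf : HasFDerivAt f f' x) :
    HasFDerivAt (fun y => L (f y)) (L.toContinuousLinearMap.comp f') x :=
  L.toContinuousLinearMap.hasFDerivAt.comp x hf

/-- The integrand of the homotopy operator. -/
def homotopyIntegrand (β : JetModel n → JetModel n [⋀^Fin (m + 1)]→L[ℝ] ℝ) (p : JetModel n × ℝ) :
    JetModel n [⋀^Fin m]→L[ℝ] ℝ :=
  p.2 ^ m • (β (fibreScale p.2 p.1)).curryLeft (horLift n p.1)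

theorem contDiff_fibreScale :
    ContDiff ℝ ∞ fun p : JetModel n × ℝ => (fibreScale p.2 p.1 : JetModel n) := by
  simp only [fibreScale_apply]
  fun_prop

theorem contDiffOn_homotopyIntegrand {β : JetModel n → JetModel n [⋀^Fin (m + 1)]→L[ℝ] ℝ}
    (hβ : ContDiffOn ℝ ∞ β (Prod.fst ⁻¹' W)) :
    ContDiffOn ℝ ∞ (homotopyIntegrand β) ((Prod.fst ⁻¹' W) ×ˢ Set.univ) := by
  refine contDiffOn_iff_eval.2 fun v => ?_
  have h1 : ContDiffOn ℝ ∞ (fun p : JetModel n × ℝ => β (fibreScale p.2 p.1))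
      ((Prod.fst ⁻¹' W) ×ˢ Set.univ) :=
    hβ.comp contDiff_fibreScale.contDiffOn fun p hp => hp.1
  have h2 : ContDiffOn ℝ ∞ (fun p : JetModel n × ℝ =>
      β (fibreScale p.2 p.1) (Matrix.vecCons (horLift n p.1) v)) ((Prod.fst ⁻¹' W) ×ˢ Set.univ) := by
    refine h1.alternating_apply fun i => ?_
    refine Fin.cases ?_ (fun j => ?_) i
    · exact ((horLift n).contDiff.comp contDiff_fst).contDiffOn
    · simpa using contDiffOn_const
  exact ContDiffOn.mul (by fun_prop) h2

/-- Product rule: `z` enters through the scaled base point and, linearly, through the vector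
`horLift n z` inserted in the first slot. -/
theorem fderiv_homotopyIntegrand (hW : IsOpen W)
    {β : JetModel n → JetModel n [⋀^Fin (m + 1)]→L[ℝ] ℝ}
    (hβ : ContDiffOn ℝ ∞ β (Prod.fst ⁻¹' W)) {z : JetModel n} (hz : z.1 ∈ W) (s : ℝ)
    (w : JetModel n) (v : Fin m → JetModel n) :
    fderiv ℝ (homotopyIntegrand β) (z, s) (w, 0) v =
      s ^ m * (fderiv ℝ β (fibreScale s z) (fibreScale s w) (Matrix.vecCons (horLift n z) v) +
        β (fibreScale s z) (Matrix.vecCons (horLift n w) v)) := by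
  have hopen : IsOpen (Prod.fst ⁻¹' W : Set (JetModel n)) := hW.preimage continuous_fst
  have hg : DifferentiableAt ℝ (homotopyIntegrand β) (z, s) :=
    ((contDiffOn_homotopyIntegrand hβ).contDiffAt
      ((hopen.prod isOpen_univ).mem_nhds (x := (z, s)) ⟨hz, trivial⟩)).differentiableAt (by simp)
  have hd : DifferentiableAt ℝ β (fibreScale s z) :=
    (hβ.contDiffAt (hopen.mem_nhds (x := fibreScale s z) hz)).differentiableAt (by simp)
  have h1 : HasFDerivAt (fun x : JetModel n => homotopyIntegrand β (x, s)) _ z :=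
    HasFDerivAt.comp (g := homotopyIntegrand β) (f := fun y => (y, s)) z hg.hasFDerivAt
      (hasFDerivAt_prodMk_left z s)
  have h0 : HasFDerivAt (fun x : JetModel n => β (fibreScale s x))
      ((fderiv ℝ β (fibreScale s z)).comp (fibreScale s)) z :=
    hd.hasFDerivAt.comp z (fibreScale s).hasFDerivAt
  have h2 := h0.linearIsometry_comp
    (G := JetModel n →L[ℝ] JetModel n [⋀^Fin m]→L[ℝ] ℝ)
    (curryLeftLI (𝕜 := ℝ) (E := JetModel n) (F := ℝ) (n := m))
  have h3 := (h2.clm_apply (horLift n).hasFDerivAt).const_smul (s ^ m)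
  have h4 := congrArg (fun f => f w v) (h1.unique h3)
  refine h4.trans ?_
  simp
  ring

/-- This is the total derivative to which the homotopy formula reduces: between `s = 0` and `s = 1`
the function rises from `0` to `β z v`. -/
theorem hasDerivAt_pow_mul_fibreScale (hW : IsOpen W)
    {β : JetModel n → JetModel n [⋀^Fin (m + 1)]→L[ℝ] ℝ}
    (hβ : ContDiffOn ℝ ∞ β (Prod.fst ⁻¹' W)) {z : JetModel n} (hz : z.1 ∈ W) (s : ℝ)
    (v : Fin (m + 1) → JetModel n) :
    HasDerivAt (fun s : ℝ => s ^ (m + 1) * β (fibreScale s z) v)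
      (s ^ (m + 1) * fderiv ℝ β (fibreScale s z) (0, z.2) v +
        (m + 1) * s ^ m * β (fibreScale s z) v) s := by
  have hopen : IsOpen (Prod.fst ⁻¹' W : Set (JetModel n)) := hW.preimage continuous_fst
  have hd : DifferentiableAt ℝ β (fibreScale s z) :=
    (hβ.contDiffAt (hopen.mem_nhds (x := fibreScale s z) hz)).differentiableAt (by simp)
  have h1 : HasDerivAt (fun s : ℝ => (fibreScale s z : JetModel n)) (0, z.2) s := by
    refine (hasDerivAt_const s z.1).prodMk ?_
    simpa using (hasDerivAt_id s).smul_const z.2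
  have h2 : HasDerivAt (fun s : ℝ => β (fibreScale s z)) _ s := hd.hasFDerivAt.comp_hasDerivAt s h1
  have h3 := (ContinuousAlternatingMap.apply ℝ (JetModel n) ℝ v).hasFDerivAt.comp_hasDerivAt s h2
  have h4 := (hasDerivAt_pow (m + 1) s).mul h3
  refine h4.congr_deriv ?_
  simp
  ring

/-- The pointwise form of the homotopy formula. -/
theorem sum_fderiv_homotopyIntegrand (hW : IsOpen W)
    {β : JetModel n → JetModel n [⋀^Fin (m + 1)]→L[ℝ] ℝ}
    (hβ : ContDiffOn ℝ ∞ β (Prod.fst ⁻¹' W))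
    (hhor : ∀ z v, β z (fun i => horProj n (v i)) = β z v)
    (hclosed : ∀ z : JetModel n, z.1 ∈ W → extDerivAlong (vertA n) β z = 0)
    {z : JetModel n} (hz : z.1 ∈ W) (s : ℝ) (v : Fin (m + 1) → JetModel n) :
    ∑ i : Fin (m + 1), (-1 : ℤ) ^ (i : ℕ) •
        fderiv ℝ (homotopyIntegrand β) (z, s) (vertA n (v i), 0) (i.removeNth v) =
      s ^ (m + 1) * fderiv ℝ β (fibreScale s z) (0, z.2) v +
        (m + 1) * s ^ m * β (fibreScale s z) v := by
  -- Vertical directions scale by `s`, which raises the weight `s ^ m` of the integrand to `s ^ (m +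
  -- 1)`.
  have h1 : ∀ w : JetModel n, (fibreScale s (vertA n w) : JetModel n) = s • vertA n w := by
    intro w; refine Prod.ext ?_ ?_ <;> simp [fibreScale_apply, vertA_apply]
  have h2 : ∀ w : JetModel n, horLift n (vertA n w) = horProj n w := fun w => rfl
  have h3 : ∀ w : JetModel n, horProj n (horProj n w) = horProj n w := fun w => rfl
  have h4 : ∀ (w : JetModel n) (u : Fin m → JetModel n),
      β (fibreScale s z) (Matrix.vecCons (horProj n w) u) =
        β (fibreScale s z) (Matrix.vecCons w u) := by
    intro w u
    rw [← hhor _ (Matrix.vecCons (horProj n w) u), ← hhor _ (Matrix.vecCons w u)]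
    congr 1
    funext i
    refine Fin.cases ?_ (fun j => ?_) i
    · exact h3 w
    · rfl
  -- Alternating the contraction of a form of degree `m + 1` counts each slot once; this is the
  -- origin of the factor `m + 1`.
  have h5 := congrArg (fun B => B v) (alternatizeUncurryFin_curryLeft (β (fibreScale s z)))
  simp only [ContinuousAlternatingMap.alternatizeUncurryFin_apply, curryLeft_apply_apply] at h5
  -- Closedness at the scaled point, with `horLift n z` as first argument. Since `A` sends it to the
  -- radial vector `(0, z.2)`, the first term is the radial derivative; the others are the
  -- derivative terms of `h9`.
  have h6 := congrArg (fun B => B (Matrix.vecCons (horLift n z) v))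
    (hclosed (fibreScale s z) hz)
  simp only [extDerivAlong_apply] at h6
  rw [Fin.sum_univ_succ] at h6
  have h7 : ∀ i : Fin (m + 1), i.succ.removeNth (Matrix.vecCons (horLift n z) v) =
      Matrix.vecCons (horLift n z) (i.removeNth v) := fun i => Fin.cons_comp_succ_succAbove _ _ _
  have h8 : vertA n (horLift n z) = (0, z.2) := rfl
  simp only [h7] at h6
  simp [h8, pow_succ] at h6
  have h9 : ∀ i : Fin (m + 1),
      fderiv ℝ (homotopyIntegrand β) (z, s) (vertA n (v i), 0) (i.removeNth v) =
      s ^ (m + 1) * fderiv ℝ β (fibreScale s z) (vertA n (v i))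
          (Matrix.vecCons (horLift n z) (i.removeNth v)) +
        s ^ m * β (fibreScale s z) (Matrix.vecCons (v i) (i.removeNth v)) := by
    intro i
    refine (fderiv_homotopyIntegrand hW hβ hz s (vertA n (v i)) (i.removeNth v)).trans ?_
    rw [h1, h2, h4, map_smul]
    simp
    ring
  simp only [h9, zsmul_eq_mul, mul_add, Finset.sum_add_distrib]
  have h10 : ∀ (a : ℝ) (c : Fin (m + 1) → ℝ),
      ∑ i : Fin (m + 1), (((-1 : ℤ) ^ (i : ℕ) : ℤ) : ℝ) * (a * c i) =
        a * ∑ i : Fin (m + 1), (-1) ^ (i : ℕ) * c i := by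
    intro a c
    rw [Finset.mul_sum]
    refine Finset.sum_congr rfl fun i _ => ?_
    push_cast
    ring
  simp at h5
  rw [h10, h10, h5]
  linear_combination -s ^ (m + 1) * h6

/-- The homotopy operator. -/
def homotopyOp (β : JetModel n → JetModel n [⋀^Fin (m + 1)]→L[ℝ] ℝ) (z : JetModel n) :
    JetModel n [⋀^Fin m]→L[ℝ] ℝ :=
  ∫ s in (0 : ℝ)..1, homotopyIntegrand β (z, s)

/-- After differentiation under the integral sign the alternating sum is an exact `s`-derivative,
and the fundamental theorem of calculus applies. -/
theorem extDerivAlong_homotopyOp (hW : IsOpen W)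
    {β : JetModel n → JetModel n [⋀^Fin (m + 1)]→L[ℝ] ℝ}
    (hβ : ContDiffOn ℝ ∞ β (Prod.fst ⁻¹' W))
    (hhor : ∀ z v, β z (fun i => horProj n (v i)) = β z v)
    (hclosed : ∀ z : JetModel n, z.1 ∈ W → extDerivAlong (vertA n) β z = 0)
    {z : JetModel n} (hz : z.1 ∈ W) :
    extDerivAlong (vertA n) (homotopyOp β) z = β z := by
  have hopen : IsOpen (Prod.fst ⁻¹' W : Set (JetModel n)) := hW.preimage continuous_fst
  have hg := contDiffOn_homotopyIntegrand hβ
  ext v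
  have h1 : ∀ i : Fin (m + 1),
      fderiv ℝ (homotopyOp β) z (vertA n (v i)) (i.removeNth v) = ∫ s in (0 : ℝ)..1,
        fderiv ℝ (homotopyIntegrand β) (z, s) (vertA n (v i), 0) (i.removeNth v) := fun i =>
    fderiv_parametric_integral_apply hopen (hg.of_le (by simp)) hz (vertA n (v i))
      (ContinuousAlternatingMap.apply ℝ (JetModel n) ℝ (i.removeNth v))
  have h2 : ∀ i : Fin (m + 1), Continuous fun s : ℝ => (-1 : ℤ) ^ (i : ℕ) •
      fderiv ℝ (homotopyIntegrand β) (z, s) (vertA n (v i), 0) (i.removeNth v) := by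
    intro i
    have := continuous_fderiv_slice_apply hopen (hg.of_le (by simp)) hz (vertA n (v i))
      (ContinuousAlternatingMap.apply ℝ (JetModel n) ℝ (i.removeNth v))
    exact this.const_smul ((-1 : ℤ) ^ (i : ℕ))
  have h3 : ∀ s : ℝ, HasDerivAt (fun s : ℝ => s ^ (m + 1) * β (fibreScale s z) v)
      (∑ i : Fin (m + 1), (-1 : ℤ) ^ (i : ℕ) •
        fderiv ℝ (homotopyIntegrand β) (z, s) (vertA n (v i), 0) (i.removeNth v)) s := fun s =>
    (hasDerivAt_pow_mul_fibreScale hW hβ hz s v).congr_deriv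
      (sum_fderiv_homotopyIntegrand hW hβ hhor hclosed hz s v).symm
  have h4 : ∀ i : Fin (m + 1), (-1 : ℤ) ^ (i : ℕ) • (∫ s in (0 : ℝ)..1,
      fderiv ℝ (homotopyIntegrand β) (z, s) (vertA n (v i), 0) (i.removeNth v)) =
      ∫ s in (0 : ℝ)..1, (-1 : ℤ) ^ (i : ℕ) •
        fderiv ℝ (homotopyIntegrand β) (z, s) (vertA n (v i), 0) (i.removeNth v) := by
    intro i
    simp only [zsmul_eq_mul]
    exact (intervalIntegral.integral_const_mul _ _).symm
  rw [extDerivAlong_apply]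
  simp only [h1, h4]
  rw [← intervalIntegral.integral_finsetSum fun i _ => (h2 i).intervalIntegrable _ _,
    intervalIntegral.integral_eq_sub_of_hasDerivAt (fun s _ => h3 s)
      ((continuous_finsetSum _ fun i _ => h2 i).intervalIntegrable _ _)]
  -- The upper endpoint gives `β z v`; the lower one vanishes because the exponent `m + 1` is
  -- positive, whatever the degree.
  have h5 : (fibreScale 1 z : JetModel n) = z := by
    rw [fibreScale_apply, one_smul]
  simp [h5]

/-- A fibrewise closed semi-basic form on `W × ℝⁿ` has a fibrewise primitive. -/
theorem exists_primitive (hW : IsOpen W)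
    {β : JetModel n → JetModel n [⋀^Fin (m + 1)]→L[ℝ] ℝ}
    (hβ : ContDiffOn ℝ ∞ β (Prod.fst ⁻¹' W))
    (hsb : ∀ z : JetModel n, z.1 ∈ W → ∀ (v : Fin (m + 1) → JetModel n) (i : Fin (m + 1)),
      (v i).1 = 0 → β z v = 0)
    (hclosed : ∀ z : JetModel n, z.1 ∈ W → ∀ v : Fin (m + 2) → JetModel n,
      (∀ i, modelDt n (v i) = 0) → extDerivAlong (vertA n) β z v = 0) :
    ∃ H : JetModel n → JetModel n [⋀^Fin m]→L[ℝ] ℝ, ContDiffOn ℝ ∞ H (Prod.fst ⁻¹' W) ∧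
      ∀ z : JetModel n, z.1 ∈ W → ∀ v : Fin (m + 1) → JetModel n,
        (∀ i, modelDt n (v i) = 0) → extDerivAlong (vertA n) H z v = β z v := by
  have hopen : IsOpen (Prod.fst ⁻¹' W : Set (JetModel n)) := hW.preimage continuous_fst
  -- The homotopy formula needs invariance under `horProj` for all arguments, while `β` has it only
  -- on the kernel of `dt`. Precomposition forces it without changing the restriction to that
  -- kernel.
  let β' : JetModel n → JetModel n [⋀^Fin (m + 1)]→L[ℝ] ℝ := fun z =>
    (β z).compContinuousLinearMap (horProj n)
  have hβ' : ContDiffOn ℝ ∞ β' (Prod.fst ⁻¹' W) := hβ.alternating_comp contDiffOn_const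
  have hdiff : ∀ {γ : JetModel n → JetModel n [⋀^Fin (m + 1)]→L[ℝ] ℝ},
      ContDiffOn ℝ ∞ γ (Prod.fst ⁻¹' W) → ∀ {z : JetModel n}, z.1 ∈ W →
        DifferentiableAt ℝ γ z := fun hγ z hz =>
    (hγ.contDiffAt (hopen.mem_nhds hz)).differentiableAt (by simp)
  have heq : ∀ z : JetModel n, z.1 ∈ W → ∀ v : Fin (m + 1) → JetModel n,
      (∀ i, modelDt n (v i) = 0) → β' z v = β z v := fun z hz v hv =>
    comp_horProj_of_semibasic (hsb z hz) hv
  have hcl : ∀ z : JetModel n, z.1 ∈ W → extDerivAlong (vertA n) β' z = 0 := by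
    intro z hz
    ext v
    -- Both `vertA` and `β'` are unchanged by a prior `horProj`, whose values lie in the kernel of
    -- `dt`. Closedness on the kernel thus becomes closedness on all arguments.
    have h1 : extDerivAlong (vertA n) β' z v =
        extDerivAlong (vertA n) β' z (fun i => horProj n (v i)) := by
      rw [extDerivAlong_apply, extDerivAlong_apply]
      refine Finset.sum_congr rfl fun i _ => ?_
      rw [← fderiv_alternating_apply (hdiff hβ' hz), ← fderiv_alternating_apply (hdiff hβ' hz)]
      rfl
    rw [h1, extDerivAlong_congr (α := modelDt n) (hdiff hβ' hz) (hdiff hβ hz) _ fun i => rfl]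
    · exact hclosed z hz _ fun i => rfl
    · filter_upwards [hopen.mem_nhds hz] with z' hz' using heq z' hz'
  refine ⟨homotopyOp β', contDiffOn_parametric_integral hopen (contDiffOn_homotopyIntegrand hβ'),
    fun z hz v hv => ?_⟩
  rw [extDerivAlong_homotopyOp hW hβ' (fun _ _ => rfl) hcl hz]
  exact heq z hz v hv

end Model

end JetForms

end

noncomputable section

namespace JetForms

/-! ### Forms on manifolds in charts -/

section Charts

variable {V : Type*} [NormedAddCommGroup V] [NormedSpace ℝ V]
  {P : Type*} [TopologicalSpace P] [ChartedSpace V P] {k : ℕ}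

theorem mdifferentiable_of_mem_smooth_atlas [IsManifold 𝓘(ℝ, V) ∞ P] {φ : OpenPartialHomeomorph P V}
    (hφ : φ ∈ atlas V P) : φ.MDifferentiable 𝓘(ℝ, V) 𝓘(ℝ, V) :=
  have : IsManifold 𝓘(ℝ, V) 1 P := .of_le (n := ∞) (by simp)
  mdifferentiable_of_mem_atlas hφ

/-- The value of a form at a point, recovered from its expression in a chart. -/
theorem formInChart_comp_mvfderiv {φ : OpenPartialHomeomorph P V}
    (hφ : φ.MDifferentiable 𝓘(ℝ, V) 𝓘(ℝ, V)) (η : FormField V P k) {u : P} (hu : u ∈ φ.source) :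
    (formInChart φ η (φ u)).compContinuousLinearMap (mvfderiv 𝓘(ℝ, V) φ u) = η u := by
  -- The points `φ.symm (φ u)` and `u` are equal only propositionally; the values of `η` there are
  -- compared by viewing both tangent spaces as `V`.
  have key : ∀ (u' : P) (_ : u' = u) (L : V →L[ℝ] V) (v : Fin k → V),
      ((η u') fun i => L (v i)) = ((η u) fun i => L (v i)) := by
    rintro u' rfl L v
    rfl
  ext v
  refine (key (φ.symm (φ u)) (φ.left_inv hu) (mfderiv 𝓘(ℝ, V) 𝓘(ℝ, V) φ.symm (φ u))
    (fun i => mfderiv 𝓘(ℝ, V) 𝓘(ℝ, V) φ u (v i))).trans ?_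
  congr 1
  funext i
  exact congrArg (fun f => f (v i)) (hφ.symm_comp_deriv hu)

/-- Allows a form on the manifold to be prescribed by its expression in one chart. -/
theorem formInChart_of_eq_comp {φ : OpenPartialHomeomorph P V}
    (hφ : φ.MDifferentiable 𝓘(ℝ, V) 𝓘(ℝ, V)) (H : V → V [⋀^Fin k]→L[ℝ] ℝ) {z : V}
    (hz : z ∈ φ.target) :
    formInChart φ (fun u => (H (φ u)).compContinuousLinearMap (mvfderiv 𝓘(ℝ, V) φ u)) z = H z := by
  ext v
  have h1 : ∀ w : V, mvfderiv 𝓘(ℝ, V) φ (φ.symm z)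
      (mfderiv 𝓘(ℝ, V) 𝓘(ℝ, V) φ.symm z w) = w := fun w =>
    congrArg (fun f => f w) (hφ.comp_symm_deriv hz)
  have h2 : formInChart φ (fun u => (H (φ u)).compContinuousLinearMap (mvfderiv 𝓘(ℝ, V) φ u)) z v =
      H (φ (φ.symm z)) fun i => mvfderiv 𝓘(ℝ, V) φ (φ.symm z)
        (mfderiv 𝓘(ℝ, V) 𝓘(ℝ, V) φ.symm z (v i)) := rfl
  rw [h2, φ.right_inv hz]
  congr 1
  funext i
  exact h1 (v i)

variable [IsManifold 𝓘(ℝ, V) ∞ P]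

theorem contDiffOn_chart_transition {φ ψ : OpenPartialHomeomorph P V} (hφ : φ ∈ atlas V P)
    (hψ : ψ ∈ atlas V P) :
    ContDiffOn ℝ ∞ (φ ∘ ψ.symm) (ψ.target ∩ ψ.symm ⁻¹' φ.source) := by
  have h1 := contMDiffOn_of_mem_maximalAtlas (I := 𝓘(ℝ, V)) (n := ∞)
    (IsManifold.subset_maximalAtlas hφ)
  have h2 := contMDiffOn_symm_of_mem_maximalAtlas (I := 𝓘(ℝ, V)) (n := ∞)
    (IsManifold.subset_maximalAtlas hψ)
  exact (h1.comp (h2.mono Set.inter_subset_left) fun _ hz => hz.2).contDiffOn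

/-- Change of charts for the expression of a form. -/
theorem formInChart_eq_pullback {φ ψ : OpenPartialHomeomorph P V} (hφ : φ ∈ atlas V P)
    (hψ : ψ ∈ atlas V P) (η : FormField V P k) {z : V} (hz : z ∈ ψ.target)
    (hz' : ψ.symm z ∈ φ.source) :
    formInChart ψ η z = (formInChart φ η ((φ ∘ ψ.symm) z)).compContinuousLinearMap
      (fderiv ℝ (φ ∘ ψ.symm) z) := by
  have hφd := mdifferentiable_of_mem_smooth_atlas hφ
  have hψd := mdifferentiable_of_mem_smooth_atlas hψ
  have h1 := mfderiv_comp z (hφd.mdifferentiableAt hz') (hψd.mdifferentiableAt_symm hz)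
  rw [mfderiv_eq_fderiv] at h1
  rw [h1]
  ext v
  exact (congrArg (fun B => B fun i => mfderiv 𝓘(ℝ, V) 𝓘(ℝ, V) ψ.symm z (v i))
    (formInChart_comp_mvfderiv hφd η hz')).symm

theorem SmoothFormOn.contDiffAt {η : FormField V P k} {U : Set P} (hη : SmoothFormOn η U)
    {φ : OpenPartialHomeomorph P V} (hφ : φ ∈ atlas V P) {u : P} (hu : u ∈ φ.source)
    (hU : U ∈ 𝓝 u) : ContDiffAt ℝ ∞ (formInChart φ η) (φ u) := by
  refine (hη φ hφ).contDiffAt (Filter.inter_mem (φ.open_target.mem_nhds (φ.map_source hu)) ?_)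
  exact (φ.tendsto_symm hu) hU

/-- The exterior derivative may be computed in any chart. -/
theorem extD_eq {η : FormField V P k} {U : Set P} (hη : SmoothFormOn η U)
    {φ : OpenPartialHomeomorph P V} (hφ : φ ∈ atlas V P) {u : P} (hu : u ∈ φ.source)
    (hU : U ∈ 𝓝 u) :
    extD η u = (extDeriv (formInChart φ η) (φ u)).compContinuousLinearMap
      (mvfderiv 𝓘(ℝ, V) φ u) := by
  obtain ⟨ψ, hψu⟩ : ∃ ψ, ψ = chartAt V u := ⟨_, rfl⟩
  have hψ : ψ ∈ atlas V P := hψu ▸ chart_mem_atlas V u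
  have huψ : u ∈ ψ.source := hψu ▸ mem_chart_source V u
  have hz : ψ u ∈ ψ.target ∩ ψ.symm ⁻¹' φ.source :=
    ⟨ψ.map_source huψ, by rw [Set.mem_preimage, ψ.left_inv huψ]; exact hu⟩
  have hopen : IsOpen (ψ.target ∩ ψ.symm ⁻¹' φ.source) := ψ.symm.isOpen_inter_preimage φ.open_source
  have hτ : ContDiffAt ℝ ∞ (φ ∘ ψ.symm) (ψ u) :=
    (contDiffOn_chart_transition hφ hψ).contDiffAt (hopen.mem_nhds hz)
  have hτu : (φ ∘ ψ.symm) (ψ u) = φ u := congrArg φ (ψ.left_inv huψ)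
  have h1 : formInChart ψ η =ᶠ[𝓝 (ψ u)] fun z =>
      (formInChart φ η ((φ ∘ ψ.symm) z)).compContinuousLinearMap (fderiv ℝ (φ ∘ ψ.symm) z) := by
    filter_upwards [hopen.mem_nhds hz] with z hz using formInChart_eq_pullback hφ hψ η hz.1 hz.2
  have hd : DifferentiableAt ℝ (formInChart φ η) ((φ ∘ ψ.symm) (ψ u)) := by
    rw [hτu]
    exact (hη.contDiffAt hφ hu hU).differentiableAt (by simp)
  -- Independence of the chart is the naturality of `d` under the transition map.
  have h2 := extDeriv_pullback (r := ∞) hd hτ (by rw [minSmoothness_of_isRCLikeNormedField]; exact ENat.LEInfty.out)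
  have h3 : mvfderiv 𝓘(ℝ, V) φ u =
      (fderiv ℝ (φ ∘ ψ.symm) (ψ u)).comp (mvfderiv 𝓘(ℝ, V) ψ u) := by
    have hψd := mdifferentiable_of_mem_smooth_atlas hψ
    have h4 : (φ : P → V) =ᶠ[𝓝 u] (φ ∘ ψ.symm) ∘ ψ := by
      filter_upwards [ψ.open_source.mem_nhds huψ] with w hw
      exact congrArg φ (ψ.left_inv hw).symm
    have h5 := mfderiv_comp u (hτ.differentiableAt (by simp)).mdifferentiableAt
      (hψd.mdifferentiableAt huψ)
    rw [mfderiv_eq_fderiv] at h5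
    exact (h4.mfderiv_eq (I := 𝓘(ℝ, V)) (I' := 𝓘(ℝ, V))).trans h5
  rw [extD, ← hψu, h1.extDeriv_eq, h2, hτu, h3]
  rfl

/-- A form on a chart domain is smooth if its expression in that chart is. -/
theorem smoothFormOn_source [FiniteDimensional ℝ V] {η : FormField V P k}
    {φ : OpenPartialHomeomorph P V} (hφ : φ ∈ atlas V P)
    (h : ContDiffOn ℝ ∞ (formInChart φ η) φ.target) : SmoothFormOn η φ.source := by
  intro ψ hψ
  have hopen : IsOpen (ψ.target ∩ ψ.symm ⁻¹' φ.source) := ψ.symm.isOpen_inter_preimage φ.open_source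
  have hτ := contDiffOn_chart_transition hφ hψ
  have h1 : ContDiffOn ℝ ∞ (fun z => formInChart φ η ((φ ∘ ψ.symm) z))
      (ψ.target ∩ ψ.symm ⁻¹' φ.source) := h.comp hτ fun z hz => φ.map_source hz.2
  exact (h1.alternating_comp (hτ.fderiv_of_isOpen hopen (by simp))).congr fun z hz =>
    formInChart_eq_pullback hφ hψ η hz.1 hz.2

end Charts

/-! ### Forms on the jet bundle in induced charts -/

section JetCharts

variable {n : ℕ} {M : Type*} [TopologicalSpace M] [ChartedSpace (BaseModel n) M]
  [IsManifold 𝓘(ℝ, BaseModel n) ∞ M] {π : FibredOverReal n M} {k : ℕ}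
  {e : OpenPartialHomeomorph M (BaseModel n)}

theorem jetChart_mem_atlas (he : IsFibredChart π e) :
    jetChart e he ∈ atlas (JetModel n) (Jet π) := ⟨e, he, rfl⟩

theorem jetChart_mdifferentiable (he : IsFibredChart π e) :
    (jetChart e he).MDifferentiable 𝓘(ℝ, JetModel n) 𝓘(ℝ, JetModel n) :=
  mdifferentiable_of_mem_smooth_atlas (jetChart_mem_atlas he)

theorem contDiff_modelJ : ContDiff ℝ ∞ fun z : JetModel n => modelJ z.2 := by
  refine contDiff_clm_apply_iff.2 fun v => ?_
  simp only [modelJ_apply]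
  fun_prop

/-- The derivative of the chart intertwines `vertEndo` with `modelJ` by `vertEndo_eq`, and insertion
of an endomorphism is compatible with such a change of frame. -/
theorem formInChart_insertField (he : IsFibredChart π e) (η : FormField (JetModel n) (Jet π) k)
    {z : JetModel n} (hz : z ∈ (jetChart e he).target) :
    formInChart (jetChart e he) (insertField (vertEndo π) η) z =
      insertEndo (modelJ z.2) (formInChart (jetChart e he) η z) := by
  have hφd := jetChart_mdifferentiable he
  have hu : (jetChart e he).symm z ∈ (jetChart e he).source := (jetChart e he).map_target hz
  have h1 := vertEndo_eq he ((jetChart e he).symm z) hu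
  have h2 : jetCoord e ((jetChart e he).symm z) = z := (jetChart e he).right_inv hz
  rw [h2] at h1
  set L := mfderiv 𝓘(ℝ, JetModel n) 𝓘(ℝ, JetModel n) (jetChart e he).symm z with hL
  have h3 : ∀ w : JetModel n, mvfderiv 𝓘(ℝ, JetModel n) (jetChart e he) ((jetChart e he).symm z)
      (L w) = w := fun w => congrArg (fun f => f w) (hφd.comp_symm_deriv hz)
  have h4 : ∀ X : TangentSpace 𝓘(ℝ, JetModel n) ((jetChart e he).symm z),
      L (mvfderiv 𝓘(ℝ, JetModel n) (jetChart e he) ((jetChart e he).symm z) X) = X := by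
    intro X
    have := congrArg (fun f => f X) (hφd.symm_comp_deriv hu)
    have h5 : (jetChart e he) ((jetChart e he).symm z) = z := (jetChart e he).right_inv hz
    rw [h5] at this
    exact this
  have h5 : ∀ w : JetModel n, vertEndo π ((jetChart e he).symm z) (L w) = L (modelJ z.2 w) := by
    intro w
    have := congrArg (fun f => f (L w)) h1
    simp only [ContinuousLinearMap.comp_apply] at this
    rw [h3] at this
    rw [← h4 (vertEndo π _ (L w)), this]
  ext v
  rw [insertEndo_apply]
  refine (insertEndo_apply _ _ _).trans ?_
  refine Finset.sum_congr rfl fun i _ => ?_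
  change _ = η ((jetChart e he).symm z) fun j => L (Function.update v i (modelJ z.2 (v i)) j)
  congr 1
  funext j
  by_cases hj : j = i
  · subst hj
    simp only [Function.update_self]
    exact h5 (v j)
  · simp only [Function.update_of_ne hj]
    rfl

/-- Needed so that the term `d i_J η` of `d_J η` can also be computed in an arbitrary induced chart.
-/
theorem SmoothFormOn.insertField_vertEndo {η : FormField (JetModel n) (Jet π) k} {U : Set (Jet π)}
    (hη : SmoothFormOn η U) : SmoothFormOn (insertField (vertEndo π) η) U := by
  rintro _ ⟨e, he, rfl⟩
  exact ((hη _ (jetChart_mem_atlas he)).insertEndo contDiff_modelJ.contDiffOn).congr fun z hz =>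
    formInChart_insertField he η hz.1

theorem dt_eq (he : IsFibredChart π e) {u : Jet π} (hu : u ∈ (jetChart e he).source)
    (X : TangentSpace 𝓘(ℝ, JetModel n) u) :
    dt π u X = modelDt n (mvfderiv 𝓘(ℝ, JetModel n) (jetChart e he) u X) := by
  have hφd := jetChart_mdifferentiable he
  have h1 : (fun w : Jet π => π.proj w.base) =ᶠ[𝓝 u] modelDt n ∘ jetChart e he := by
    filter_upwards [(jetChart e he).open_source.mem_nhds hu] with w hw
    exact (he.2 _ hw).symm
  have h2 := mfderiv_comp (I' := 𝓘(ℝ, JetModel n)) (I'' := 𝓘(ℝ, ℝ)) u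
    (modelDt n).differentiableAt.mdifferentiableAt (hφd.mdifferentiableAt hu)
  rw [mfderiv_eq_fderiv, ContinuousLinearMap.fderiv] at h2
  exact congrArg (fun f => f X) ((h1.mfderiv_eq (I := 𝓘(ℝ, JetModel n)) (I' := 𝓘(ℝ, ℝ))).trans h2)

/-- In an induced chart `π₁₀` is the first projection followed by `e.symm`. This turns semi-basicity
into a condition on chart components. -/
theorem mfderiv_base_eq_zero (he : IsFibredChart π e) {u : Jet π}
    (hu : u ∈ (jetChart e he).source) {X : TangentSpace 𝓘(ℝ, JetModel n) u}
    (hX : (mvfderiv 𝓘(ℝ, JetModel n) (jetChart e he) u X).1 = 0) :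
    mfderiv 𝓘(ℝ, JetModel n) 𝓘(ℝ, BaseModel n) Jet.base u X = 0 := by
  have hφd := jetChart_mdifferentiable he
  have hue : u.base ∈ e.source := hu
  have h1 : (Jet.base : Jet π → M) =ᶠ[𝓝 u]
      e.symm ∘ (ContinuousLinearMap.fst ℝ (BaseModel n) (EuclideanSpace ℝ (Fin n)) ∘
        jetChart e he) := by
    filter_upwards [(jetChart e he).open_source.mem_nhds hu] with w hw
    exact (e.left_inv hw).symm
  have hfst : MDifferentiableAt 𝓘(ℝ, JetModel n) 𝓘(ℝ, BaseModel n)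
      (ContinuousLinearMap.fst ℝ (BaseModel n) (EuclideanSpace ℝ (Fin n))) (jetChart e he u) :=
    (ContinuousLinearMap.differentiableAt _).mdifferentiableAt
  have h2 := mfderiv_comp (I' := 𝓘(ℝ, JetModel n)) (I'' := 𝓘(ℝ, BaseModel n)) u
    hfst (hφd.mdifferentiableAt hu)
  rw [mfderiv_eq_fderiv, ContinuousLinearMap.fderiv] at h2
  have h3 := mfderiv_comp (I' := 𝓘(ℝ, BaseModel n)) (I'' := 𝓘(ℝ, BaseModel n)) u
    (he.mdifferentiable.mdifferentiableAt_symm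
      (x := (ContinuousLinearMap.fst ℝ (BaseModel n) (EuclideanSpace ℝ (Fin n)) ∘
        jetChart e he) u) (e.map_source hue))
    (hfst.comp u (hφd.mdifferentiableAt hu))
  rw [h2] at h3
  have h4 := h1.mfderiv_eq (I := 𝓘(ℝ, JetModel n)) (I' := 𝓘(ℝ, BaseModel n))
  have h5 := congrArg (fun f => f X) (h4.trans h3)
  refine h5.trans ?_
  refine Eq.trans (congrArg (mfderiv 𝓘(ℝ, BaseModel n) 𝓘(ℝ, BaseModel n) e.symm _) hX) ?_
  exact map_zero _

theorem exists_mvfderiv_jetChart_eq (he : IsFibredChart π e) {u : Jet π}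
    (hu : u ∈ (jetChart e he).source) (w : JetModel n) :
    ∃ X, mvfderiv 𝓘(ℝ, JetModel n) (jetChart e he) u X = w :=
  (jetChart_mdifferentiable he).mfderiv_surjective hu w

theorem exists_dt_eq_one (u : Jet π) : ∃ X, dt π u X = 1 := by
  obtain ⟨e, he, hu⟩ := exists_isFibredChart π u.base
  have hu' : u ∈ (jetChart e he).source := hu
  obtain ⟨X, hX⟩ := exists_mvfderiv_jetChart_eq he hu' ((1, 0), 0)
  exact ⟨X, by rw [dt_eq he hu', hX, modelDt_apply]⟩

/-- The dictionary between identities modulo `dt` and identities on the kernel of `dt`; it rests on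
`dt` being nowhere zero. -/
theorem wedgeOne_dt_eq_iff {u : Jet π}
    {η η' : TangentSpace 𝓘(ℝ, JetModel n) u [⋀^Fin k]→L[ℝ] ℝ} :
    wedgeOne η (dt π u) = wedgeOne η' (dt π u) ↔
      ∀ X, (∀ i, dt π u (X i) = 0) → η X = η' X := by
  obtain ⟨Y, hY⟩ := exists_dt_eq_one u
  exact ⟨fun h X hX => eqOn_ker_of_wedgeOne_eq hY h hX, wedgeOne_eq_of_eqOn_ker hY⟩

/-- An identity on the kernel of `dt`, expressed in an induced chart. -/
theorem formInChart_eqOn_ker (he : IsFibredChart π e) {θ : FormField (JetModel n) (Jet π) k}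
    {C : JetModel n [⋀^Fin k]→L[ℝ] ℝ} {u : Jet π} (hu : u ∈ (jetChart e he).source)
    (h : ∀ X, (∀ i, dt π u (X i) = 0) →
      θ u X = C fun i => mvfderiv 𝓘(ℝ, JetModel n) (jetChart e he) u (X i))
    {v : Fin k → JetModel n} (hv : ∀ i, modelDt n (v i) = 0) :
    formInChart (jetChart e he) θ (jetChart e he u) v = C v := by
  choose X hX using fun i => exists_mvfderiv_jetChart_eq he hu (v i)
  have h1 := h X fun i => by rw [dt_eq he hu, hX, hv]
  rw [← formInChart_comp_mvfderiv (jetChart_mdifferentiable he) θ hu] at h1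
  have h2 : (fun i => mvfderiv 𝓘(ℝ, JetModel n) (jetChart e he) u (X i)) = v := funext hX
  rw [h2] at h1
  rw [← h1, ← h2]
  rfl

/-- In an induced chart, and on the kernel of `dt`, the derivation `d_J` is `d_A` for the constant
endomorphism `A = ∂/∂yⁱ ⊗ dxⁱ`. -/
theorem extDAlong_vertEndo_apply (he : IsFibredChart π e) {η : FormField (JetModel n) (Jet π) k}
    {U : Set (Jet π)} (hη : SmoothFormOn η U) {u : Jet π} (hu : u ∈ (jetChart e he).source)
    (hU : U ∈ 𝓝 u) (X : Fin (k + 1) → TangentSpace 𝓘(ℝ, JetModel n) u)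
    (hX : ∀ i, dt π u (X i) = 0) :
    extDAlong (vertEndo π) η u X =
      extDerivAlong (vertA n) (formInChart (jetChart e he) η) (jetChart e he u)
        (fun i => mvfderiv 𝓘(ℝ, JetModel n) (jetChart e he) u (X i)) := by
  have hφ := jetChart_mem_atlas he
  set φ := jetChart e he with hφdef
  set L := mvfderiv 𝓘(ℝ, JetModel n) φ u with hL
  have hker : ∀ i, modelDt n (L (X i)) = 0 := fun i => (dt_eq he hu (X i)).symm.trans (hX i)
  have h1 : extD (insertField (vertEndo π) η) u X =
      extDeriv (fun z => insertEndo (modelJ z.2) (formInChart φ η z)) (φ u) fun i => L (X i) := by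
    rw [extD_eq hη.insertField_vertEndo hφ hu hU]
    have : formInChart φ (insertField (vertEndo π) η) =ᶠ[𝓝 (φ u)]
        fun z => insertEndo (modelJ z.2) (formInChart φ η z) := by
      filter_upwards [φ.open_target.mem_nhds (φ.map_source hu)] with z hz
        using formInChart_insertField he η hz
    rw [this.extDeriv_eq]
    rfl
  have h2 : insertField (vertEndo π) (extD η) u X =
      insertEndo (modelJ (φ u).2) (extDeriv (formInChart φ η) (φ u)) fun i => L (X i) := by
    rw [insertField, insertEndo_apply, insertEndo_apply, extD_eq hη hφ hu hU]
    refine Finset.sum_congr rfl fun i _ => ?_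
    refine congrArg (extDeriv (formInChart φ η) (φ u)) ?_
    funext j
    by_cases hj : j = i
    · subst hj
      simp only [Function.update_self]
      exact congrArg (fun f => f (X j)) (vertEndo_eq he u hu)
    · simp only [Function.update_of_ne hj]
      rfl
  have hd := hη.contDiffAt hφ hu hU
  have hd' : DifferentiableAt ℝ (fun z => insertEndo (modelJ z.2) (formInChart φ η z)) (φ u) := by
    have h3 := (hη.insertField_vertEndo).contDiffAt hφ hu hU
    refine (h3.differentiableAt (by simp)).congr_of_eventuallyEq ?_
    filter_upwards [φ.open_target.mem_nhds (φ.map_source hu)] with z hz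
      using (formInChart_insertField he η hz).symm
  have h4 := insertEndo_extDeriv_sub (A := vertA n) (α := modelDt n) (J := fun z => modelJ z.2)
    (fun z v hv => modelJ_eq_vertA z.2 hv) (hd.differentiableAt (by simp)) hd' hker
  rw [← h4, ← h1, ← h2]
  rfl

end JetCharts

end JetForms

end

noncomputable section

namespace JetForms

/-! ### Closedness, local exactness and the lemma itself -/

section Main

variable {n : ℕ} {M : Type*} [TopologicalSpace M] [ChartedSpace (BaseModel n) M]
  [IsManifold 𝓘(ℝ, BaseModel n) ∞ M] {π : FibredOverReal n M}

/-- Exact forms are closed (modulo `dt`). -/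
theorem IsExactModOn.isClosedMod {k : ℕ} {θ : FormField (JetModel n) (Jet π) k}
    (hθ : SmoothFormOn θ Set.univ) (hex : IsExactModOn (vertEndo π) (dt π) Set.univ θ) :
    IsClosedMod (vertEndo π) (dt π) θ := by
  intro u
  obtain ⟨e, he, hue⟩ := exists_isFibredChart π u.base
  have hφ := jetChart_mem_atlas he
  have hu : u ∈ (jetChart e he).source := hue
  have hd := (hθ.contDiffAt hφ hu Filter.univ_mem).differentiableAt (by simp)
  have htarget := (jetChart e he).open_target.mem_nhds ((jetChart e he).map_source hu)
  rw [← wedgeOne_zero (dt π u), wedgeOne_dt_eq_iff]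
  intro X hX
  rw [extDAlong_vertEndo_apply he hθ hu Filter.univ_mem X hX]
  have hX' : ∀ i, modelDt n (mvfderiv 𝓘(ℝ, JetModel n) (jetChart e he) u (X i)) = 0 :=
    fun i => (dt_eq he hu (X i)).symm.trans (hX i)
  cases k with
  | zero =>
    -- In degree zero there are no arguments to restrict, so exactness says that `θ` vanishes, and
    -- its chart expression is compared with the constant `0`.
    have hex' : ∀ u' : Jet π, ∀ Y, (∀ i, dt π u' (Y i) = 0) → θ u' Y = 0 := by
      intro u'
      refine (wedgeOne_dt_eq_iff (η' := 0)).1 ?_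
      rw [wedgeOne_zero]
      exact hex u' trivial
    rw [extDerivAlong_congr (α := modelDt n) hd
      (differentiableAt_const (0 : JetModel n [⋀^Fin 0]→L[ℝ] ℝ)) _ hX']
    · simp [extDerivAlong_apply]
    · filter_upwards [htarget] with z hz v hv
      have := formInChart_eqOn_ker (C := 0) he ((jetChart e he).map_target hz)
        (fun Y hY => hex' _ Y hY) hv
      rwa [(jetChart e he).right_inv hz] at this
  | succ k =>
    obtain ⟨η, hη, hex⟩ := hex
    have hη2 := (hη.contDiffAt hφ hu Filter.univ_mem).of_le (m := 2) ENat.LEInfty.out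
    -- Near the point the chart expression of `θ` agrees with `d_A` of that of `η` on the kernel, so
    -- `d_A θ` may be replaced there by `d_A (d_A η) = 0`.
    rw [extDerivAlong_congr (α := modelDt n) hd
      (hasFDerivAt_extDerivAlong (A := vertA n) hη2).differentiableAt _ hX',
      extDerivAlong_extDerivAlong hη2]
    · rfl
    · filter_upwards [htarget] with z hz v hv
      have hz' := (jetChart e he).map_target hz
      have := formInChart_eqOn_ker he hz' (fun Y hY =>
        (wedgeOne_dt_eq_iff.1 (hex _ trivial) Y hY).trans
          (extDAlong_vertEndo_apply he hη hz' Filter.univ_mem Y hY)) hv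
      rwa [(jetChart e he).right_inv hz] at this

/-- Closed semi-basic forms are exact (modulo `dt`) on the domain of every induced chart. -/
theorem isExactModOn_jetChart_source {m : ℕ} {θ : FormField (JetModel n) (Jet π) (m + 1)}
    (hθ : SmoothFormOn θ Set.univ) (hsb : IsSemiBasic θ)
    (hcl : IsClosedMod (vertEndo π) (dt π) θ)
    {e : OpenPartialHomeomorph M (BaseModel n)} (he : IsFibredChart π e) :
    IsExactModOn (vertEndo π) (dt π) (jetChart e he).source θ := by
  have hφ := jetChart_mem_atlas he
  have hφd := jetChart_mdifferentiable he
  -- The chart target is `e.target` times the whole fibre, hence stable under the scalings of the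
  -- homotopy; no shrinking is needed.
  have hsmooth : ContDiffOn ℝ ∞ (formInChart (jetChart e he) θ) (Prod.fst ⁻¹' e.target) :=
    (hθ _ hφ).mono fun z hz => ⟨hz, trivial⟩
  have hlift : ∀ z : JetModel n, z.1 ∈ e.target →
      ∃ u : Jet π, u ∈ (jetChart e he).source ∧ jetChart e he u = z := fun z hz =>
    ⟨_, (jetChart e he).map_target hz, (jetChart e he).right_inv hz⟩
  have hsb' : ∀ z : JetModel n, z.1 ∈ e.target → ∀ (v : Fin (m + 1) → JetModel n)
      (i : Fin (m + 1)), (v i).1 = 0 → formInChart (jetChart e he) θ z v = 0 := by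
    intro z hz v i hi
    obtain ⟨u, hu, rfl⟩ := hlift z hz
    choose X hX using fun i => exists_mvfderiv_jetChart_eq he hu (v i)
    have h1 := hsb u X i (mfderiv_base_eq_zero he hu (by rw [hX, hi]))
    rw [← formInChart_comp_mvfderiv hφd θ hu] at h1
    obtain rfl : (fun i => mvfderiv 𝓘(ℝ, JetModel n) (jetChart e he) u (X i)) = v := funext hX
    exact h1
  have hcl' : ∀ z : JetModel n, z.1 ∈ e.target → ∀ v : Fin (m + 2) → JetModel n,
      (∀ i, modelDt n (v i) = 0) →
        extDerivAlong (vertA n) (formInChart (jetChart e he) θ) z v = 0 := by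
    intro z hz v hv
    obtain ⟨u, hu, rfl⟩ := hlift z hz
    choose X hX using fun i => exists_mvfderiv_jetChart_eq he hu (v i)
    have hX' : ∀ i, dt π u (X i) = 0 := fun i => by rw [dt_eq he hu, hX, hv]
    have h1 : extDAlong (vertEndo π) θ u X = 0 := by
      refine (wedgeOne_dt_eq_iff (η' := 0)).1 ?_ X hX'
      rw [wedgeOne_zero]
      exact hcl u
    rw [extDAlong_vertEndo_apply he hθ hu Filter.univ_mem X hX'] at h1
    obtain rfl : (fun i => mvfderiv 𝓘(ℝ, JetModel n) (jetChart e he) u (X i)) = v := funext hX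
    exact h1
  obtain ⟨H, hH, hHθ⟩ := exists_primitive e.open_target hsmooth hsb' hcl'
  -- The primitive found in coordinates, pulled back by the chart; only its values on the chart
  -- domain matter.
  let η : FormField (JetModel n) (Jet π) m := fun u =>
    (H (jetChart e he u)).compContinuousLinearMap (mvfderiv 𝓘(ℝ, JetModel n) (jetChart e he) u)
  have hηH : ∀ z ∈ (jetChart e he).target, formInChart (jetChart e he) η z = H z := fun z hz =>
    formInChart_of_eq_comp hφd H hz
  have hη : SmoothFormOn η (jetChart e he).source :=
    smoothFormOn_source hφ (hH.congr hηH)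
  refine ⟨η, hη, fun u hu => wedgeOne_dt_eq_iff.2 fun X hX => ?_⟩
  have htarget := (jetChart e he).map_source hu
  rw [extDAlong_vertEndo_apply he hη hu ((jetChart e he).open_source.mem_nhds hu) X hX,
    ← formInChart_comp_mvfderiv hφd θ hu]
  have h1 : extDerivAlong (vertA n) (formInChart (jetChart e he) η) (jetChart e he u) =
      extDerivAlong (vertA n) H (jetChart e he u) := by
    have h2 : formInChart (jetChart e he) η =ᶠ[𝓝 (jetChart e he u)] H := by
      filter_upwards [(jetChart e he).open_target.mem_nhds htarget] with z hz using hηH z hz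
    rw [extDerivAlong, h2.fderiv_eq, extDerivAlong]
  rw [h1, hHθ _ htarget _ fun i => (dt_eq he hu (X i)).symm.trans (hX i)]
  rfl

end Main

end JetForms

end

open JetForms in
theorem lemma2p4 {n : ℕ} {M : Type*} [TopologicalSpace M] [ChartedSpace (BaseModel n) M]
    [IsManifold 𝓘(ℝ, BaseModel n) ∞ M] (π : FibredOverReal n M) :
    (∀ (k : ℕ) (θ : FormField (JetModel n) (Jet π) k), SmoothFormOn θ Set.univ →
      IsExactModOn (vertEndo π) (dt π) Set.univ θ → IsClosedMod (vertEndo π) (dt π) θ) ∧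
    (∀ (k : ℕ) (θ : FormField (JetModel n) (Jet π) k), 1 ≤ k → SmoothFormOn θ Set.univ →
      IsSemiBasic θ → IsClosedMod (vertEndo π) (dt π) θ →
      ∀ u : Jet π, ∃ U : Set (Jet π), IsOpen U ∧ u ∈ U ∧
        IsExactModOn (vertEndo π) (dt π) U θ) := by
  refine ⟨fun k θ hθ hex => IsExactModOn.isClosedMod hθ hex, fun k θ hk hθ hsb hcl u => ?_⟩
  obtain ⟨m, rfl⟩ : ∃ m, k = m + 1 := ⟨k - 1, by omega⟩
  obtain ⟨e, he, hu⟩ := exists_isFibredChart π u.base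
  exact ⟨(jetChart e he).source, (jetChart e he).open_source, hu,
    isExactModOn_jetChart_source hθ hsb hcl he⟩
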